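/- Let $\Omega\subset\mathbb{R}^3$ be a bounded open set, and let $\mu,\alpha,N>0$, $1\le\beta\le 3$ and $\tau\in\mathbb{R}$. Let $\mathcal V=\{\varphi\in (C_0^\infty(\Omega))^3:\operatorname{div}\varphi=0\}$, let $H$ be the closure of $\mathcal V$ in $(L^2(\Omega))^3$, with inner product $(\cdot,\cdot)$, and let $V$ be the closure of $\mathcal V$ in $(H_0^1(\Omega))^3$, with inner product $((u,v))=\sum_{i=1}^3\int_\Omega \partial_i u\cdot\partial_i v\,dx$ and norm $\|u\|=((u,u))^{1/2}$. Put $F_N(r)=\min(1,N/r)$ for $r>0$, $F_N(0)=1$, and $$b(u,v,w)=\sum_{i,j=1}^3\int_\Omega u_i\,\frac{\partial v_j}{\partial x_i}\,w_j\,dx\qquad(u,v,w\in V).$$ Let $u_\tau\in H$ and let $f\in L^2(\tau,T;H)$ for all $T>\tau$. For $T>\tau$, a weak solution on $[\tau,T]$ of the globally modified Navier–Stokes equations with damping $$u_t-\mu\Delta u+F_N(\|u\|)(u\cdot\nabla)u+\nabla p+\alpha F_N(\|u\|^{\beta-1})|u|^{\beta-1}u=f,\quad \operatorname{div}u=0,\quad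 u|_{\partial\Omega}=0,\quad u(\tau)=u_\tau,$$ is a function $u\in L^\infty(\tau,T;H)\cap L^2(\tau,T;V)$ with $F_N(\|u\|^{\beta-1})u\in L^{\beta+1}(\tau,T;(L^{\beta+1}(\Omega))^3)$ such that, for every $w\in V\cap(L^{\beta+1}(\Omega))^3$, $$\frac{d}{dt}(u,w)+\mu((u,w))+F_N(\|u\|)\,b(u,u,w)+\alpha F_N(\|u\|^{\beta-1})\int_\Omega|u|^{\beta-1}u\cdot w\,dx=(f,w)$$ in the sense of scalar distributions on $(\tau,T)$, and such that $u(\tau)=u_\tau$, where $u(\tau)$ is the value at $\tau$ of the representative of $u$ that is continuous from $[\tau,T]$ to $H$ with its weak topology. A global weak solution is a function on $[\tau,\infty)$ that is a weak solution on $[\tau,T]$ for every $T>\tau$. Then the weak solution is unique: for every $T>\tau$, any two weak solutions $u,v$ on $[\tau,T]$ (with the same $f$ and $u_\tau$) coincide, that is, $u(t)=v(t)$ for almost every $t\in(\tau,T)$, and for every $t\in[\tau,T]$ if $u$ and $v$ are weakly continuous from $[\tau,T]$ to $H$. Likewise, any two global weak solutions coincide almost everywhere on $(\tau,\infty)$,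 and everywhere on $[\tau,\infty)$ if they are weakly continuous. -/

import Mathlib

open MeasureTheory Set Filter Topology
open scoped ENNReal ContDiff

noncomputable section

namespace GMNSED

/-- Three-dimensional Euclidean space. -/
abbrev E3 : Type := EuclideanSpace ℝ (Fin 3)

/-- The Hilbert space `(L²(Ω))³`. -/
abbrev L2 (Ω : Set E3) : Type := Lp E3 2 (volume.restrict Ω)

/-- The partial derivative `∂φ/∂xᵢ` of a vector field. -/
def partialDeriv (i : Fin 3) (φ : E3 → E3) (x : E3) : E3 :=
  fderiv ℝ φ x (EuclideanSpace.single i 1)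

/-- The divergence of a vector field. -/
def divergence (φ : E3 → E3) (x : E3) : ℝ :=
  ∑ i : Fin 3, partialDeriv i φ x i

/-- The space `𝒱` of divergence-free fields in `(C₀^∞(Ω))³`. -/
def testFields (Ω : Set E3) : Set (E3 → E3) :=
  {φ | ContDiff ℝ ∞ φ ∧ HasCompactSupport φ ∧ tsupport φ ⊆ Ω ∧ ∀ x, divergence φ x = 0}

/-- `H`: the closure of `𝒱` in `(L²(Ω))³`, with the norm and inner product of `(L²(Ω))³`. -/
def H (Ω : Set E3) : Submodule ℝ (L2 Ω) :=
  (Submodule.span ℝ {g : L2 Ω | ∃ φ ∈ testFields Ω,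
    (g : E3 → E3) =ᵐ[volume.restrict Ω] φ}).topologicalClosure

/-- The Hilbert space of tuples `(u, (g₁, g₂, g₃))` of elements of `(L²(Ω))³`. The space
`(H¹(Ω))³` sits in it isometrically through `u ↦ (u, (∂₁u, ∂₂u, ∂₃u))`. -/
abbrev H1Ambient (Ω : Set E3) : Type :=
  WithLp 2 (L2 Ω × PiLp 2 (fun _ : Fin 3 => L2 Ω))

/-- `V`: the closure of `𝒱` in `(H₀¹(Ω))³`. An element is stored as the tuple of `u` and its
(weak) partial derivatives; convergence in the ambient space is convergence in `H¹`. -/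
def V (Ω : Set E3) : Submodule ℝ (H1Ambient Ω) :=
  (Submodule.span ℝ {z : H1Ambient Ω | ∃ φ ∈ testFields Ω,
    (z.fst : E3 → E3) =ᵐ[volume.restrict Ω] φ ∧
    ∀ i : Fin 3, (z.snd i : E3 → E3) =ᵐ[volume.restrict Ω] partialDeriv i φ}).topologicalClosure

variable {Ω : Set E3}

/-- The field `u ∈ (L²(Ω))³` underlying an element of `V`. -/
def toField (u : V Ω) : L2 Ω := (u : H1Ambient Ω).fst

/-- The partial derivatives `(∂₁u, ∂₂u, ∂₃u)` of an element of `V`. -/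
def grad (u : V Ω) : PiLp 2 (fun _ : Fin 3 => L2 Ω) := (u : H1Ambient Ω).snd

/-- The inner product `((u,v)) = ∑ᵢ ∫_Ω ∂ᵢu · ∂ᵢv dx` of `V`. -/
def innerV (u v : V Ω) : ℝ := inner ℝ (grad u) (grad v)

/-- The norm `‖u‖ = ((u,u))^{1/2}` of `V`. -/
def normV (u : V Ω) : ℝ := ‖grad u‖

/-- The trilinear form `b(u,v,w) = ∑_{i,j} ∫_Ω uᵢ (∂vⱼ/∂xᵢ) wⱼ dx`. -/
def b (u v w : V Ω) : ℝ :=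
  ∫ x in Ω, ∑ i : Fin 3, ∑ j : Fin 3,
    (toField u : E3 → E3) x i * (grad v i : E3 → E3) x j * (toField w : E3 → E3) x j

/-- The damping pairing `(|u|^{β-1} u, w) = ∫_Ω |u|^{β-1} u · w dx`. -/
def damping (β : ℝ) (u w : V Ω) : ℝ :=
  ∫ x in Ω, ‖(toField u : E3 → E3) x‖ ^ (β - 1) *
    inner ℝ ((toField u : E3 → E3) x) ((toField w : E3 → E3) x)

/-- The cutoff `F_N(r) = min(1, N/r)` for `r ≥ 0`, with `F_N(0) = 1`. -/
def cutoff (N r : ℝ) : ℝ := if r = 0 then 1 else min 1 (N / r)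

/-- The modified trilinear form `b_N(u,v,w) = F_N(‖v‖) b(u,v,w)`. -/
def bN (N : ℝ) (u v w : V Ω) : ℝ := cutoff N (normV v) * b u v w

/-- Membership of `g` in `L^q(τ,T;(L^q(Ω))³)`, for `1 ≤ q < ∞`. It is applied to functions that
are strongly measurable in time with values in `(L²(Ω))³`, so measurability in time is not
repeated. -/
def MemLqLq (Ω : Set E3) (τ T q : ℝ) (g : ℝ → E3 → E3) : Prop :=
  (∀ᵐ t ∂volume.restrict (Ioo τ T), MemLp (g t) (ENNReal.ofReal q) (volume.restrict Ω)) ∧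
  ∫⁻ t in Ioo τ T, eLpNorm (g t) (ENNReal.ofReal q) (volume.restrict Ω) ^ q < ⊤

/-- `u ∈ C([τ,T]; H_w)`: continuity in time for the weak topology of `H`. -/
def WeaklyContinuousOn (u : ℝ → H Ω) (s : Set ℝ) : Prop :=
  ∀ h : H Ω, ContinuousOn (fun t => inner ℝ (u t) h) s

/-- `u(τ) = u_τ`, where `u` is identified up to null sets of times in `(τ,T)` and its value at
`τ` is that of its representative in `C([τ,T]; H_w)`. -/
def HasInitialValue (τ T : ℝ) (u : ℝ → H Ω) (uτ : H Ω) : Prop :=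
  ∃ u' : ℝ → H Ω, WeaklyContinuousOn u' (Icc τ T) ∧
    (∀ᵐ t ∂volume.restrict (Ioo τ T), u' t = u t) ∧ u' τ = uτ

/-- `U ∈ L²(τ,T;V)` is the function `u`, regarded as taking values in `V` for a.e. time. -/
def IsL2VVersion (τ T : ℝ) (u : ℝ → H Ω) (U : ℝ → V Ω) : Prop :=
  MemLp U 2 (volume.restrict (Ioo τ T)) ∧
  ∀ᵐ t ∂volume.restrict (Ioo τ T), toField (U t) = (u t : L2 Ω)

/-- The equation
`d/dt (u,w) + μ((u,w)) + b_N(u,u,w) + α F_N(‖u‖^{β-1}) (|u|^{β-1}u, w) = (f,w)`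
in the sense of scalar distributions on `(τ,T)`, for every `w ∈ V ∩ (L^{β+1}(Ω))³`. -/
def SatisfiesEquation (μ α β N τ T : ℝ) (f u : ℝ → H Ω) (U : ℝ → V Ω) : Prop :=
  ∀ w : V Ω, MemLp (toField w : E3 → E3) (ENNReal.ofReal (β + 1)) (volume.restrict Ω) →
    ∀ φ : ℝ → ℝ, ContDiff ℝ ∞ φ → HasCompactSupport φ → tsupport φ ⊆ Ioo τ T →
      -(∫ t in Ioo τ T, inner ℝ (u t : L2 Ω) (toField w) * deriv φ t)
        + ∫ t in Ioo τ T, (μ * innerV (U t) w + bN N (U t) (U t) w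
            + α * (cutoff N (normV (U t) ^ (β - 1)) * damping β (U t) w)) * φ t
      = ∫ t in Ioo τ T, inner ℝ (f t : L2 Ω) (toField w) * φ t

/-- Weak solutions on `[τ,T]` of the globally modified Navier–Stokes equations with damping,
with `f ∈ L²(τ,T;H)` and initial value `u_τ ∈ H`. -/
def IsWeakSolution (μ α β N τ T : ℝ) (f : ℝ → H Ω) (uτ : H Ω) (u : ℝ → H Ω) : Prop :=
  MemLp u ⊤ (volume.restrict (Ioo τ T)) ∧
  HasInitialValue τ T u uτ ∧
  ∃ U : ℝ → V Ω, IsL2VVersion τ T u U ∧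
    MemLqLq Ω τ T (β + 1) (fun t x =>
      cutoff N (normV (U t) ^ (β - 1)) • (toField (U t) : E3 → E3) x) ∧
    SatisfiesEquation μ α β N τ T f u U

/-- Global weak solutions: weak solutions on `[τ,T]` for every `T > τ`. -/
def IsGlobalWeakSolution (μ α β N τ : ℝ) (f : ℝ → H Ω) (uτ : H Ω) (u : ℝ → H Ω) : Prop :=
  ∀ T, τ < T → IsWeakSolution μ α β N τ T f uτ u

end GMNSED

end

/-! Write the equation as `u' + A u = f` in the dual of `V`, where `A` (called `operator`) collects
viscosity, convection and damping. For two solutions the difference `w = u - v` satisfies `w' = A v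
- A u` and `w(τ) = 0`. If `w` may be paired with its own equation, then `|w(t)|² = -2 ∫ ⟨A u - A v,
u - v⟩`, and the bound `⟨A u - A v, u - v⟩ ≥ -C |u - v|²` in the `L²` norm leads to `w = 0` by
Grönwall.

The pairing is legitimate because the cutoffs give `A` linear growth from `V` to its dual
(`norm_operator_le`): `F_N(r) r ≤ N` removes one power of the gradient norm from the convection
term, and `β - 1` powers from the damping term. The latter lies in `L²` since `2β ≤ 6` and `V`
embeds in `L⁶`. Hence `w ∈ L²(V)` and `w' ∈ L²(V')`, and `energy_identity` applies.

The lower bound (`exists_operator_sub_ge`) has two nonlinear parts. For convection, `b(v,w,w) = 0`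
and the Lipschitz estimate of `F_N` bound the difference by a multiple of `N ‖w‖ · |w|^{1/2}
‖w‖^{1/2}`, through the `L⁶`-`L²`-`L³` Hölder inequality and interpolation of `L³`. For damping,
`|u|^{β-1} u` is monotone, so only the difference of the two cutoffs contributes, at most a multiple
of `N ‖w‖ |w|`. Young's inequality absorbs both into `μ ‖w‖²` at the cost of `C |w|²`. -/

noncomputable section
namespace GMNSED

/-! ### Grönwall's lemma and distributional derivatives on an interval -/

/-- Integral form of Grönwall's lemma with an inequality that holds almost everywhere. -/
theorem ae_nonpos_of_le_mul_integral {a b C : ℝ} {y : ℝ → ℝ}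
    (hy : IntegrableOn y (Ioo a b)) (hy0 : ∀ t, 0 ≤ y t)
    (h : ∀ᵐ t ∂volume.restrict (Ioo a b), y t ≤ C * ∫ s in a..t, y s) :
    ∀ᵐ t ∂volume.restrict (Ioo a b), y t ≤ 0 := by
  rcases le_or_gt b a with hab | hab
  · simp [Ioo_eq_empty (not_lt.2 hab)]
  have hyI : IntervalIntegrable y volume a b :=
    (intervalIntegrable_iff_integrableOn_Ioo_of_le hab.le).2 hy
  set Y : ℝ → ℝ := fun t => ∫ s in a..t, y s with hY
  have hYc : ContinuousOn Y (Icc a b) := by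
    have := intervalIntegral.continuousOn_primitive_interval'
      (a := a) hyI (by simp)
    rwa [uIcc_of_le hab.le] at this
  have hY0 : ∀ t ∈ Icc a b, 0 ≤ Y t := fun t ht =>
    intervalIntegral.integral_nonneg ht.1 fun s _ => hy0 s
  -- Since `y` need not be continuous, the inequality is integrated once more: `Y ≤ C Z` holds at
  -- every point, and `Z` has the right derivative `Y`, so uniqueness for `|Z'| ≤ C |Z|`, `Z(a) = 0`
  -- applies.
  set Z : ℝ → ℝ := fun t => ∫ s in a..t, Y s with hZ
  have hYI : IntervalIntegrable Y volume a b :=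
    ContinuousOn.intervalIntegrable (by rwa [uIcc_of_le hab.le])
  have hZc : ContinuousOn Z (Icc a b) := by
    have := intervalIntegral.continuousOn_primitive_interval'
      (a := a) hYI (by simp)
    rwa [uIcc_of_le hab.le] at this
  have hZ0 : ∀ t ∈ Icc a b, 0 ≤ Z t := fun t ht =>
    intervalIntegral.integral_nonneg ht.1 fun s hs => hY0 s ⟨hs.1, hs.2.trans ht.2⟩
  have hYZ : ∀ t ∈ Icc a b, Y t ≤ C * Z t := by
    intro t ht
    have hsub : uIcc a t ⊆ uIcc a b := by
      rw [uIcc_of_le ht.1, uIcc_of_le hab.le]; exact Icc_subset_Icc_right ht.2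
    rw [hZ, hY]
    simp only
    rw [← intervalIntegral.integral_const_mul]
    refine intervalIntegral.integral_mono_ae_restrict ht.1 (hyI.mono_set hsub)
      ((hYI.mono_set hsub).const_mul C) ?_
    have : Ioo a t ⊆ Ioo a b := Ioo_subset_Ioo_right ht.2
    rw [← restrict_Ioo_eq_restrict_Icc]
    exact ae_restrict_of_ae_restrict_of_subset this h
  have hZz : ∀ t ∈ Icc a b, Z t = 0 := by
    refine eq_zero_of_abs_deriv_le_mul_abs_self_of_eq_zero_right (f' := Y) (K := C) hZc ?_
      (by simp [hZ]) ?_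
    · intro x hx
      have h1 : ContinuousWithinAt Y (Ici x) x :=
        ((hYc x ⟨hx.1, hx.2.le⟩).mono_of_mem_nhdsWithin (by
          refine mem_of_superset (Icc_mem_nhdsGE hx.2) (Icc_subset_Icc_left hx.1)))
      have hsub : uIcc a x ⊆ uIcc a b := by
        rw [uIcc_of_le hx.1, uIcc_of_le hab.le]; exact Icc_subset_Icc_right hx.2.le
      refine intervalIntegral.integral_hasDerivWithinAt_right (hYI.mono_set hsub) (t := Ioi x) ?_
        (h1.mono Ioi_subset_Ici_self)
      have : StronglyMeasurableAtFilter Y (𝓝[Icc x b] x) :=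
        ((hYc.mono (Icc_subset_Icc_left hx.1)).stronglyMeasurableAtFilter_nhdsWithin
          measurableSet_Icc x)
      refine StronglyMeasurableAtFilter.filter_mono this ?_
      rw [nhdsWithin_Icc_eq_nhdsGE hx.2]
      exact nhdsWithin_mono _ Ioi_subset_Ici_self
    · intro x hx
      have hx' : x ∈ Icc a b := ⟨hx.1, hx.2.le⟩
      rw [Real.norm_of_nonneg (hY0 x hx'), Real.norm_of_nonneg (hZ0 x hx')]
      exact hYZ x hx'
  filter_upwards [h, ae_restrict_mem measurableSet_Ioo] with t ht htm
  have htm' : t ∈ Icc a b := ⟨htm.1.le, htm.2.le⟩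
  have h1 : Y t = 0 := le_antisymm (by simpa [hZz t htm'] using hYZ t htm') (hY0 t htm')
  simpa [← hY, h1] using (show y t ≤ C * Y t from ht)

/-- A smooth function with compact support in `(a,b)` and vanishing integral is the derivative of
such a function. -/
theorem exists_test_primitive {a b : ℝ} {ψ : ℝ → ℝ} (hψ : ContDiff ℝ ∞ ψ)
    (hc : HasCompactSupport ψ) (hs : tsupport ψ ⊆ Ioo a b) (h0 : ∫ t, ψ t = 0) :
    ∃ φ : ℝ → ℝ, ContDiff ℝ ∞ φ ∧ HasCompactSupport φ ∧ tsupport φ ⊆ Ioo a b ∧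
      ∀ t, deriv φ t = ψ t := by
  rcases (tsupport ψ).eq_empty_or_nonempty with he | hne
  · refine ⟨0, contDiff_const, HasCompactSupport.zero, by simp, fun t => ?_⟩
    rw [tsupport_eq_empty_iff] at he
    simp [he]
  have hcomp : IsCompact (tsupport ψ) := hc
  obtain ⟨m, hm, hml⟩ := hcomp.exists_isLeast hne
  obtain ⟨M, hM, hMl⟩ := hcomp.exists_isGreatest hne
  have hzl : ∀ t, t < m → ψ t = 0 := fun t ht =>
    image_eq_zero_of_notMem_tsupport fun hh => not_le.2 ht (hml hh)
  have hd : ∀ t, HasDerivAt (fun t => ∫ s in m..t, ψ s) (ψ t) t := fun t =>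
    intervalIntegral.integral_hasDerivAt_right (hψ.continuous.intervalIntegrable _ _)
      (hψ.continuous.stronglyMeasurableAtFilter _ _) hψ.continuous.continuousAt
  -- Left of `m` the integrand vanishes; right of `M` the integral already exhausts the support and
  -- equals `∫ ψ = 0`.
  have hsub : Function.support (fun t => ∫ s in m..t, ψ s) ⊆ Icc m M := by
    intro t ht
    by_contra hcon
    refine ht ?_
    rw [mem_Icc, not_and_or, not_le, not_le] at hcon
    rcases hcon with h1 | h1
    · refine intervalIntegral.integral_zero_ae ?_
      have : ∀ᵐ x : ℝ, x ≠ m := by simp [ae_iff, measure_singleton]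
      filter_upwards [this] with x hx hxm
      rw [uIoc_of_ge h1.le] at hxm
      exact hzl x (lt_of_le_of_ne hxm.2 hx)
    · have : Function.support ψ ⊆ Icc m M := fun x hx => by
        have := subset_tsupport _ hx
        exact ⟨hml this, hMl this⟩
      change ∫ s in m..t, ψ s = 0
      rw [← h0, ← setIntegral_eq_integral_of_forall_compl_eq_zero (s := Icc m t),
        intervalIntegral.integral_of_le ((hml hM).trans h1.le), integral_Icc_eq_integral_Ioc]
      intro x hx
      by_contra h2
      have := this h2
      exact hx ⟨this.1, this.2.trans h1.le⟩
  have hts : tsupport (fun t => ∫ s in m..t, ψ s) ⊆ Icc m M :=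
    closure_minimal hsub isClosed_Icc
  refine ⟨fun t => ∫ s in m..t, ψ s, ?_, ?_, ?_, fun t => (hd t).deriv⟩
  · rw [contDiff_infty_iff_deriv]
    refine ⟨fun t => (hd t).differentiableAt, ?_⟩
    have : deriv (fun t => ∫ s in m..t, ψ s) = ψ := funext fun t => (hd t).deriv
    rwa [this]
  · exact HasCompactSupport.of_support_subset_isCompact isCompact_Icc hsub
  · exact hts.trans (Icc_subset_Ioo (hs hm).1 (hs hM).2)

theorem integrableOn_mul_test {a b : ℝ} {q ψ : ℝ → ℝ} (hq : IntegrableOn q (Ioo a b))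
    (hψ : Continuous ψ) (hc : HasCompactSupport ψ) :
    IntegrableOn (fun t => q t * ψ t) (Ioo a b) := by
  obtain ⟨B, hB⟩ := hc.exists_bound_of_continuous hψ
  exact hq.mul_bdd hψ.aestronglyMeasurable (Eventually.of_forall hB)

/-- A continuous function on `[a,b]` that vanishes at `a` and whose distributional derivative is
an integrable function is the primitive of that function. -/
theorem eq_integral_of_distribDeriv {a b : ℝ} (hab : a < b) {c g : ℝ → ℝ}
    (hc : ContinuousOn c (Icc a b)) (hca : c a = 0) (hg : IntegrableOn g (Ioo a b))
    (h : ∀ φ : ℝ → ℝ, ContDiff ℝ ∞ φ → HasCompactSupport φ → tsupport φ ⊆ Ioo a b →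
      -∫ t in Ioo a b, c t * deriv φ t = ∫ t in Ioo a b, g t * φ t) :
    ∀ t ∈ Icc a b, c t = ∫ s in a..t, g s := by
  have hgI : IntervalIntegrable g volume a b :=
    (intervalIntegrable_iff_integrableOn_Ioo_of_le hab.le).2 hg
  set P : ℝ → ℝ := fun t => ∫ s in a..t, g s with hP
  have hPac : AbsolutelyContinuousOnInterval P a b :=
    hgI.absolutelyContinuousOnInterval_intervalIntegral (by simp)
  have hPc : ContinuousOn P (Icc a b) := by
    have := hPac.continuousOn
    rwa [uIcc_of_le hab.le] at this
  set k : ℝ → ℝ := fun t => c t - P t with hk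
  have hkc : ContinuousOn k (Icc a b) := hc.sub hPc
  have hkI : IntegrableOn k (Ioo a b) :=
    (hkc.integrableOn_Icc).mono_set Ioo_subset_Icc_self
  have hmain : ∀ φ : ℝ → ℝ, ContDiff ℝ ∞ φ → HasCompactSupport φ → tsupport φ ⊆ Ioo a b →
      ∫ t in Ioo a b, k t * deriv φ t = 0 := by
    intro φ h1 h2 h3
    have hφac : AbsolutelyContinuousOnInterval φ a b := by
      have := (h1.of_le (m := 1) (by norm_num)).lipschitzWith_of_hasCompactSupport h2 (by norm_num)
      obtain ⟨K, hK⟩ := this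
      exact (hK.lipschitzOnWith).absolutelyContinuousOnInterval
    have h4 := hPac.integral_mul_deriv_eq_deriv_mul hφac
    have ha : φ a = 0 := image_eq_zero_of_notMem_tsupport fun hh => lt_irrefl _ (h3 hh).1
    have hb : φ b = 0 := image_eq_zero_of_notMem_tsupport fun hh => lt_irrefl _ (h3 hh).2
    have hae : ∫ x in a..b, deriv P x * φ x = ∫ x in a..b, g x * φ x := by
      refine intervalIntegral.integral_congr_ae ?_
      filter_upwards [hgI.ae_hasDerivAt_integral] with x hx hxm
      rw [(hx (uIoc_subset_uIcc hxm) a (by simp)).deriv]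
    rw [ha, hb, hae] at h4
    simp only [mul_zero, sub_zero, zero_sub] at h4
    rw [intervalIntegral.integral_of_le hab.le, intervalIntegral.integral_of_le hab.le,
      integral_Ioc_eq_integral_Ioo, integral_Ioc_eq_integral_Ioo] at h4
    have hdc : Continuous (deriv φ) := h1.continuous_deriv (by simp)
    simp only [hk, sub_mul]
    rw [integral_sub, h4, sub_neg_eq_add, ← h φ h1 h2 h3]
    · ring
    · exact integrableOn_mul_test (hc.integrableOn_Icc.mono_set Ioo_subset_Icc_self) hdc h2.deriv
    · exact integrableOn_mul_test (hPc.integrableOn_Icc.mono_set Ioo_subset_Icc_self) hdc h2.deriv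
  obtain ⟨ρ, hρ1, hρ2, hρ3, hρ4, hρ5⟩ := exists_contDiff_tsupport_subset (n := ⊤)
    (isOpen_Ioo.mem_nhds (show (a + b) / 2 ∈ Ioo a b by constructor <;> linarith))
  have hρ0 : 0 < ∫ t, ρ t := by
    refine (hρ3.continuous.integral_pos_of_hasCompactSupport_nonneg_nonzero (x := (a + b) / 2) hρ2
      (fun t => (hρ4 (mem_range_self t)).1) (by simp [hρ5]))
  -- The du Bois-Reymond argument: subtracting from `ψ` a multiple of the bump `ρ` makes its
  -- integral zero, hence `ψ - I ρ` is an admissible `φ'`. Thus `k` integrates against `ψ` like the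
  -- constant `K`, its weighted mean against `ρ`.
  set K : ℝ := (∫ t in Ioo a b, k t * ρ t) / ∫ t, ρ t with hK
  have hae : ∀ᵐ t, t ∈ Ioo a b → k t - K = 0 := by
    refine isOpen_Ioo.ae_eq_zero_of_integral_contDiff_smul_eq_zero ?_ ?_
    · exact (hkI.sub (integrableOn_const (by simp))).locallyIntegrableOn
    · intro ψ h1 h2 h3
      set I : ℝ := (∫ t, ψ t) / ∫ t, ρ t with hI
      have hψi : Integrable ψ := h1.continuous.integrable_of_hasCompactSupport h2
      have hρi : Integrable ρ := hρ3.continuous.integrable_of_hasCompactSupport hρ2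
      have hts : tsupport (fun t => ψ t - I * ρ t) ⊆ Ioo a b := by
        refine (tsupport_sub ψ (fun t => I * ρ t)).trans (union_subset h3 ?_)
        exact (closure_mono (Function.support_mul_subset_right _ _)).trans hρ1
      obtain ⟨φ, p1, p2, p3, p4⟩ := exists_test_primitive (a := a) (b := b)
        (ψ := fun t => ψ t - I * ρ t) (h1.sub (contDiff_const.mul hρ3))
        (h2.sub hρ2.mul_left) hts (by
          rw [integral_sub hψi (hρi.const_mul I), integral_const_mul, hI]
          field_simp
          ring)
      have h5 := hmain φ p1 p2 p3
      simp only [p4, mul_sub] at h5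
      have hsupp : ∀ q : ℝ → ℝ, ∫ t, ψ t * q t = ∫ t in Ioo a b, q t * ψ t := by
        intro q
        rw [setIntegral_eq_integral_of_forall_compl_eq_zero]
        · simp only [mul_comm]
        · intro x hx
          rw [image_eq_zero_of_notMem_tsupport (fun hh => hx (h3 hh)), mul_zero]
      have h6 : ∫ t in Ioo a b, ψ t = ∫ t, ψ t :=
        setIntegral_eq_integral_of_forall_compl_eq_zero fun x hx =>
          image_eq_zero_of_notMem_tsupport (fun hh => hx (h3 hh))
      rw [integral_sub (integrableOn_mul_test hkI h1.continuous h2)] at h5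
      · have h7 : ∀ t, k t * (I * ρ t) = I * (k t * ρ t) := fun t => by ring
        simp only [h7, integral_const_mul] at h5
        simp only [smul_eq_mul]
        rw [hsupp]
        simp only [sub_mul]
        rw [integral_sub (integrableOn_mul_test hkI h1.continuous h2) (hψi.integrableOn.const_mul K),
          integral_const_mul, h6]
        have : I * ∫ t in Ioo a b, k t * ρ t = K * ∫ t, ψ t := by
          rw [hI, hK]; ring
        linarith
      · exact integrableOn_mul_test hkI (continuous_const.mul hρ3.continuous) hρ2.mul_left
  have hkK : EqOn k (fun _ => K) (Icc a b) := by
    refine Measure.eqOn_Icc_of_ae_eq volume hab.ne ?_ hkc continuousOn_const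
    rw [← restrict_Ioo_eq_restrict_Icc]
    refine (ae_restrict_iff' measurableSet_Ioo).2 ?_
    filter_upwards [hae] with t ht hm
    linarith [ht hm]
  have hK0 : K = 0 := by
    have := hkK (left_mem_Icc.2 hab.le)
    simpa [hk, hca, hP] using this.symm
  intro t ht
  have := hkK ht
  simp only [hk, hK0] at this
  linarith

/-! ### The energy identity for `W ∈ L²(X)` with derivative in `L²(X')` -/

section Energy

variable {X Y : Type*} [NormedAddCommGroup X] [NormedSpace ℝ X]
  [NormedAddCommGroup Y] [InnerProductSpace ℝ Y]

theorem memLp_comp_add_const {E : Type*} [NormedAddCommGroup E] {p : ℝ≥0∞} {f : ℝ → E}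
    (hf : MemLp f p volume) (k : ℝ) : MemLp (fun r => f (r + k)) p volume :=
  hf.comp_measurePreserving (measurePreserving_add_right volume k)

/-- Pairing two square integrable functions after small translations is continuous in the
translations. -/
theorem continuous_integral_translate_pairing {G : ℝ → StrongDual ℝ X} {W : ℝ → X}
    (hG : MemLp G 2 volume) (hW : MemLp W 2 volume) (s : Set ℝ) :
    Continuous (fun p : ℝ × ℝ => ∫ r in s, G (r + p.1) (W (r + p.2) + W r)) := by
  -- A finite exponent is what makes translation strongly continuous on `Lp`; the rest is continuity
  -- of the bilinear pairing of `L²` with `L²`.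
  have : Fact ((2 : ℝ≥0∞) ≠ ⊤) := ⟨by simp⟩
  let B : StrongDual ℝ X →L[ℝ] X →L[ℝ] ℝ := ContinuousLinearMap.id ℝ _
  let g : Lp (StrongDual ℝ X) 2 (volume : Measure ℝ) := hG.toLp G
  let w : Lp X 2 (volume : Measure ℝ) := hW.toLp W
  let RG := LpToLpRestrictCLM ℝ (StrongDual ℝ X) ℝ volume 2 s
  let RW := LpToLpRestrictCLM ℝ X ℝ volume 2 s
  have key : ∀ p : ℝ × ℝ, ∫ r in s, G (r + p.1) (W (r + p.2) + W r) =
      B.lpPairing (volume.restrict s) 2 2 (RG (DomAddAct.mk p.1 +ᵥ g))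
        (RW ((DomAddAct.mk p.2 +ᵥ w) + w)) := by
    intro p
    rw [ContinuousLinearMap.lpPairing_eq_integral]
    refine integral_congr_ae ?_
    have h1 : (DomAddAct.mk p.1 +ᵥ g : Lp (StrongDual ℝ X) 2 (volume : Measure ℝ))
        =ᵐ[volume] fun r => G (r + p.1) := by
      simp only [g]
      rw [DomAddAct.mk_vadd_toLp]
      refine (MemLp.coeFn_toLp _).trans (Eventually.of_forall fun r => ?_)
      simp [add_comm]
    have h2 : (DomAddAct.mk p.2 +ᵥ w : Lp X 2 (volume : Measure ℝ))
        =ᵐ[volume] fun r => W (r + p.2) := by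
      simp only [w]
      rw [DomAddAct.mk_vadd_toLp]
      refine (MemLp.coeFn_toLp _).trans (Eventually.of_forall fun r => ?_)
      simp [add_comm]
    filter_upwards [LpToLpRestrictCLM_coeFn ℝ s (DomAddAct.mk p.1 +ᵥ g),
      LpToLpRestrictCLM_coeFn ℝ s ((DomAddAct.mk p.2 +ᵥ w) + w), ae_restrict_of_ae h1,
      ae_restrict_of_ae h2, ae_restrict_of_ae (Lp.coeFn_add (DomAddAct.mk p.2 +ᵥ w) w),
      ae_restrict_of_ae hW.coeFn_toLp] with r e1 e2 e3 e4 e5 e6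
    simp only [RG, RW, B, ContinuousLinearMap.coe_id', id_eq]
    rw [e1, e2, e3, e5, Pi.add_apply, e4, e6]
  simp_rw [key]
  have c1 : Continuous fun p : ℝ × ℝ => RG (DomAddAct.mk p.1 +ᵥ g) := by
    refine RG.continuous.comp ?_
    have : Continuous fun p : ℝ × ℝ => (DomAddAct.mk p.1 : ℝᵈᵃᵃ) :=
      DomAddAct.continuous_mk.comp continuous_fst
    exact this.vadd continuous_const
  have c2 : Continuous fun p : ℝ × ℝ => RW ((DomAddAct.mk p.2 +ᵥ w) + w) := by
    refine RW.continuous.comp ?_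
    have : Continuous fun p : ℝ × ℝ => (DomAddAct.mk p.2 : ℝᵈᵃᵃ) :=
      DomAddAct.continuous_mk.comp continuous_snd
    exact (this.vadd continuous_const).add continuous_const
  exact ((B.lpPairing (volume.restrict s) 2 2).continuous.comp c1).clm_apply c2

/-- Supplies the hypothesis of Fubini's theorem in `energy_identity`. The integrand is dominated by
`‖G (r + k)‖² + ‖Z r‖²`; by translation invariance on the whole line the first term has the same
integral in `r` for each `k`, and `k` ranges over a bounded interval. -/
theorem integrable_translate_pairing {G : ℝ → StrongDual ℝ X} {Z : ℝ → X}
    (hG : MemLp G 2 volume) (hZ : MemLp Z 2 volume) (s : Set ℝ) (h : ℝ) :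
    Integrable (fun p : ℝ × ℝ => G (p.1 + p.2) (Z p.1))
      ((volume.restrict s).prod (volume.restrict (Ioc 0 h))) := by
  have hG2 : Integrable (fun r => ‖G r‖ ^ 2) volume := hG.integrable_norm_pow (by simp)
  have hZ2 : Integrable (fun r => ‖Z r‖ ^ 2) volume := hZ.integrable_norm_pow (by simp)
  have hle : (volume.restrict s).prod (volume.restrict (Ioc 0 h)) ≤
      (volume : Measure ℝ).prod (volume.restrict (Ioc 0 h)) :=
    Measure.prod_mono Measure.restrict_le_self le_rfl
  refine Integrable.mono_measure ?_ hle
  have hmp : Measure.QuasiMeasurePreserving (fun p : ℝ × ℝ => p.1 + p.2)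
      ((volume : Measure ℝ).prod (volume.restrict (Ioc 0 h))) volume :=
    (quasiMeasurePreserving_add volume (volume : Measure ℝ)).mono_left
      (Measure.AbsolutelyContinuous.prod Measure.AbsolutelyContinuous.rfl
        Measure.restrict_le_self.absolutelyContinuous)
  have hm : AEStronglyMeasurable (fun p : ℝ × ℝ => G (p.1 + p.2) (Z p.1))
      ((volume : Measure ℝ).prod (volume.restrict (Ioc 0 h))) := by
    have a1 := hG.1.comp_quasiMeasurePreserving hmp
    have a2 := hZ.1.comp_fst (ν := volume.restrict (Ioc 0 h))
    exact (ContinuousLinearMap.id ℝ (StrongDual ℝ X)).aestronglyMeasurable_comp₂ a1 a2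
  have i1 : Integrable (fun p : ℝ × ℝ => ‖G (p.1 + p.2)‖ ^ 2)
      ((volume : Measure ℝ).prod (volume.restrict (Ioc 0 h))) := by
    refine (integrable_prod_iff' ?_).2 ⟨?_, ?_⟩
    · exact (hG2.1.comp_quasiMeasurePreserving hmp)
    · refine Eventually.of_forall fun y => ?_
      exact hG2.comp_add_right y
    · have : ∀ y : ℝ, ∫ x, ‖‖G (x + y)‖ ^ 2‖ = ∫ x, ‖‖G x‖ ^ 2‖ := fun y =>
        integral_add_right_eq_self (fun x => ‖‖G x‖ ^ 2‖) y
      simp only [this]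
      exact integrable_const _
  have i2 : Integrable (fun p : ℝ × ℝ => ‖Z p.1‖ ^ 2)
      ((volume : Measure ℝ).prod (volume.restrict (Ioc 0 h))) := hZ2.comp_fst _
  refine (i1.add i2).mono' hm (Eventually.of_forall fun p => ?_)
  refine ((G (p.1 + p.2)).le_opNorm (Z p.1)).trans ?_
  simp only [Pi.add_apply]
  nlinarith [sq_nonneg (‖G (p.1 + p.2)‖ - ‖Z p.1‖), sq_nonneg (‖G (p.1 + p.2)‖),
    sq_nonneg ‖Z p.1‖]

/-- Energy identity: if `w = j W` with `W ∈ L²(X)` has the derivative `G ∈ L²(X')`, then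
`‖w(t)‖² = 2 ∫_{-∞}^t ⟨G, W⟩` for almost every `t`. -/
theorem energy_identity (j : X →L[ℝ] Y) {W : ℝ → X} {G : ℝ → StrongDual ℝ X} {w : ℝ → Y} {T : ℝ}
    (hG : MemLp G 2 volume) (hW : MemLp W 2 volume)
    (hw : ∀ᵐ t, t < T → w t = j (W t))
    (hder : ∀ s t, s ≤ t → t < T → ∀ z, inner ℝ (w t - w s) (j z) = ∫ r in s..t, G r z) :
    ∀ᵐ t, t < T → ‖w t‖ ^ 2 = 2 * ∫ r in Iic t, G r (W r) := by
  set y : ℝ → ℝ := fun r => ‖j (W r)‖ ^ 2 with hy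
  have hyI : Integrable y volume := by
    have : MemLp (fun r => j (W r)) 2 volume := j.comp_memLp' hW
    exact this.integrable_norm_pow (by simp)
  filter_upwards [hw, LocallyIntegrable.ae_hasDerivAt_integral hyI.locallyIntegrable] with t hwt hdt htT
  have hder1 := hdt t
  rw [hwt htT]
  change y t = _
  set Φ : ℝ × ℝ → ℝ := fun p => ∫ r in Iic t, G (r + p.1) (W (r + p.2) + W r) with hΦ
  have hΦc : Continuous Φ := continuous_integral_translate_pairing hG hW _
  have hΦ0 : Φ 0 = 2 * ∫ r in Iic t, G r (W r) := by
    simp only [hΦ, Prod.fst_zero, Prod.snd_zero, add_zero, ← two_smul ℝ (W _), map_smul,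
      smul_eq_mul]
    rw [integral_const_mul]
  -- No mollification is needed. Telescoping turns the left side into `∫_{r ≤ t} (y(r+h) - y(r))`.
  -- Each increment is `⟨w(r+h) - w(r), w(r+h) + w(r)⟩`, hence the integral of `G (r+k) (W(r+h) + W
  -- r)` over `0 < k ≤ h`, and Fubini exchanges `r` and `k`. Dividing by `h → 0` gives `y(t)` at
  -- Lebesgue points on the left and `Φ 0` on the right.
  have hkey : ∀ h, 0 < h → h < T - t → ∫ r in t..t + h, y r = ∫ k in (0)..h, Φ (k, h) := by
    intro h h0 hT
    have hZ : MemLp (fun r => W (r + h) + W r) 2 volume := (memLp_comp_add_const hW h).add hW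
    have hint := integrable_translate_pairing hG hZ (Iic t) h
    have hsw := integral_integral_swap (f := fun r k => G (r + k) (W (r + h) + W r)) hint
    rw [intervalIntegral.integral_of_le h0.le]
    simp only [hΦ]
    rw [← hsw]
    have hwh : ∀ᵐ r, r + h < T → w (r + h) = j (W (r + h)) :=
      (measurePreserving_add_right volume h).quasiMeasurePreserving.ae hw
    have e1 : ∫ r in Iic t, ∫ k in Ioc 0 h, G (r + k) (W (r + h) + W r) =
        ∫ r in Iic t, (y (r + h) - y r) := by
      refine setIntegral_congr_ae measurableSet_Iic ?_
      filter_upwards [hw, hwh] with r h1 h2 hr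
      have hr' : r ≤ t := hr
      have hrh : r + h < T := by linarith
      rw [← intervalIntegral.integral_of_le h0.le,
        intervalIntegral.integral_comp_add_left (fun x => G x (W (r + h) + W r)) r, add_zero,
        ← hder r (r + h) (by linarith) hrh, h1 (by linarith), h2 hrh, map_add]
      simp only [hy, inner_sub_left, inner_add_right, real_inner_self_eq_norm_sq]
      rw [real_inner_comm (j (W r)) (j (W (r + h)))]
      ring
    rw [e1, integral_sub (hyI.comp_add_right h).integrableOn hyI.integrableOn]
    have e2 : ∫ r in Iic t, y (r + h) = ∫ r in Iic (t + h), y r := by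
      have := (measurePreserving_add_right volume h).setIntegral_preimage_emb
        (measurableEmbedding_addRight h) y (Iic (t + h))
      rw [← this]
      congr 2
      ext x; simp
    rw [e2, intervalIntegral.integral_Iic_sub_Iic hyI.integrableOn hyI.integrableOn]
  have hslope : Tendsto (fun h : ℝ => h⁻¹ * ∫ r in t..t + h, y r) (𝓝[>] 0) (𝓝 (y t)) := by
    have := hder1.tendsto_slope_zero_right
    simpa using this
  rw [← hΦ0]
  refine tendsto_nhds_unique hslope ?_
  rw [Metric.tendsto_nhds]
  intro ε hε
  obtain ⟨δ, hδ, hδ'⟩ := Metric.continuousAt_iff.1 (hΦc.continuousAt (x := 0)) (ε / 2) (by linarith)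
  filter_upwards [Ioo_mem_nhdsGT (show (0 : ℝ) < min δ (T - t) from lt_min hδ (by linarith))]
    with h hh
  have hhδ := lt_of_lt_of_le hh.2 (min_le_left _ _)
  rw [hkey h hh.1 (lt_of_lt_of_le hh.2 (min_le_right _ _))]
  have hb : ‖∫ k in (0)..h, (Φ (k, h) - Φ 0)‖ ≤ ε / 2 * |h - 0| := by
    refine intervalIntegral.norm_integral_le_of_norm_le_const fun k hk => ?_
    rw [uIoc_of_le hh.1.le] at hk
    have := @hδ' (k, h) (by
      rw [Prod.dist_eq]
      simp only [Prod.fst_zero, Prod.snd_zero, dist_zero_right, Real.norm_eq_abs]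
      rw [abs_of_pos hk.1, abs_of_pos hh.1]
      exact max_lt (by linarith [hk.2]) hhδ)
    rw [Real.dist_eq] at this
    exact this.le
  have hcont : Continuous fun k => Φ (k, h) := hΦc.comp (by fun_prop)
  rw [intervalIntegral.integral_sub (hcont.intervalIntegrable _ _) (by simp),
    intervalIntegral.integral_const, sub_zero, abs_of_pos hh.1, Real.norm_eq_abs,
    smul_eq_mul] at hb
  rw [Real.dist_eq]
  have : h⁻¹ * (∫ k in (0)..h, Φ (k, h)) - Φ 0 =
      h⁻¹ * ((∫ k in (0)..h, Φ (k, h)) - h * Φ 0) := by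
    have := hh.1.ne'
    field_simp
  rw [this, abs_mul, abs_of_pos (inv_pos.2 hh.1)]
  calc h⁻¹ * _ ≤ h⁻¹ * (ε / 2 * h) := by
        gcongr; exact inv_nonneg.2 hh.1.le
    _ = ε / 2 := by have := hh.1.ne'; field_simp
    _ < ε := by linarith

end Energy

/-! ### The space `V` and the density of test fields -/

variable {Ω : Set E3}

/-- The embedding of `V` into `(L²(Ω))³` as a continuous linear map. -/
def toFieldL (Ω : Set E3) : V Ω →L[ℝ] L2 Ω :=
  (WithLp.fstL 2 ℝ (L2 Ω) (PiLp 2 (fun _ : Fin 3 => L2 Ω))).comp (V Ω).subtypeL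

/-- The gradient as a continuous linear map on `V`. -/
def gradL (Ω : Set E3) : V Ω →L[ℝ] PiLp 2 (fun _ : Fin 3 => L2 Ω) :=
  (WithLp.sndL 2 ℝ (L2 Ω) (PiLp 2 (fun _ : Fin 3 => L2 Ω))).comp (V Ω).subtypeL

@[simp] theorem toFieldL_apply (u : V Ω) : toFieldL Ω u = toField u := rfl

theorem toField_add (u v : V Ω) : toField (u + v) = toField u + toField v := rfl

theorem toField_sub (u v : V Ω) : toField (u - v) = toField u - toField v := rfl

theorem toField_smul (c : ℝ) (u : V Ω) : toField (c • u) = c • toField u := rfl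

theorem grad_add (u v : V Ω) : grad (u + v) = grad u + grad v := rfl

theorem grad_sub (u v : V Ω) : grad (u - v) = grad u - grad v := rfl

theorem grad_smul (c : ℝ) (u : V Ω) : grad (c • u) = c • grad u := rfl

theorem normV_nonneg (u : V Ω) : 0 ≤ normV u := norm_nonneg _

theorem normV_le_norm (u : V Ω) : normV u ≤ ‖u‖ := WithLp.norm_snd_le (x := (u : H1Ambient Ω)) ..

theorem norm_toField_le (u : V Ω) : ‖toField u‖ ≤ ‖u‖ := WithLp.norm_fst_le (x := (u : H1Ambient Ω)) ..

theorem norm_grad_apply_le (u : V Ω) (i : Fin 3) : ‖grad u i‖ ≤ normV u :=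
  PiLp.norm_apply_le _ i

theorem continuous_normV : Continuous (normV : V Ω → ℝ) := (gradL Ω).continuous.norm

/-- `u` is given by a divergence-free test field. -/
def IsTest (u : V Ω) : Prop :=
  ∃ φ ∈ testFields Ω, (toField u : E3 → E3) =ᵐ[volume.restrict Ω] φ ∧
    ∀ i : Fin 3, (grad u i : E3 → E3) =ᵐ[volume.restrict Ω] partialDeriv i φ

theorem partialDeriv_add {φ ψ : E3 → E3} (hφ : Differentiable ℝ φ) (hψ : Differentiable ℝ ψ)
    (i : Fin 3) : partialDeriv i (φ + ψ) = partialDeriv i φ + partialDeriv i ψ := by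
  ext1 x
  simp [partialDeriv, fderiv_add (hφ x) (hψ x)]

theorem partialDeriv_smul {φ : E3 → E3} (c : ℝ) (hφ : Differentiable ℝ φ)
    (i : Fin 3) : partialDeriv i (c • φ) = c • partialDeriv i φ := by
  ext1 x
  simp [partialDeriv, fderiv_const_smul (hφ x) c]

theorem testFields_add {φ ψ : E3 → E3} (hφ : φ ∈ testFields Ω) (hψ : ψ ∈ testFields Ω) :
    φ + ψ ∈ testFields Ω := by
  obtain ⟨a1, a2, a3, a4⟩ := hφ
  obtain ⟨b1, b2, b3, b4⟩ := hψ
  refine ⟨a1.add b1, a2.add b2, (tsupport_add φ ψ).trans (union_subset a3 b3), fun x => ?_⟩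
  have := a4 x
  have := b4 x
  simp only [divergence, partialDeriv_add (a1.differentiable (by simp))
    (b1.differentiable (by simp)), Pi.add_apply, PiLp.add_apply, Finset.sum_add_distrib] at *
  linarith

theorem testFields_smul {φ : E3 → E3} (c : ℝ) (hφ : φ ∈ testFields Ω) :
    c • φ ∈ testFields Ω := by
  obtain ⟨a1, a2, a3, a4⟩ := hφ
  refine ⟨contDiff_const.smul a1, a2.smul_left (f := fun _ => c),
    (closure_mono (Function.support_const_smul_subset c φ)).trans a3, fun x => ?_⟩
  have := a4 x
  simp only [divergence, partialDeriv_smul c (a1.differentiable (by simp)), Pi.smul_apply,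
    PiLp.smul_apply, smul_eq_mul, ← Finset.mul_sum] at *
  rw [this, mul_zero]

theorem zero_mem_testFields : (0 : E3 → E3) ∈ testFields Ω :=
  ⟨contDiff_const, HasCompactSupport.zero, by simp, fun x => by simp [divergence, partialDeriv]⟩

/-- The generators already form a linear subspace, so passing to the span adds nothing. Estimates
that are not linear in `u`, such as Sobolev's inequality, can therefore be proved on test fields and
extended by density. -/
theorem exists_testField_of_mem_span {z : H1Ambient Ω}
    (hz : z ∈ Submodule.span ℝ {z : H1Ambient Ω | ∃ φ ∈ testFields Ω,
      (z.fst : E3 → E3) =ᵐ[volume.restrict Ω] φ ∧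
      ∀ i : Fin 3, (z.snd i : E3 → E3) =ᵐ[volume.restrict Ω] partialDeriv i φ}) :
    ∃ φ ∈ testFields Ω, (z.fst : E3 → E3) =ᵐ[volume.restrict Ω] φ ∧
      ∀ i : Fin 3, (z.snd i : E3 → E3) =ᵐ[volume.restrict Ω] partialDeriv i φ := by
  induction hz using Submodule.span_induction with
  | mem x h => exact h
  | zero =>
    refine ⟨0, zero_mem_testFields, Lp.coeFn_zero _ _ _, fun i => ?_⟩
    refine (Lp.coeFn_zero E3 2 (volume.restrict Ω)).trans (Eventually.of_forall fun x => ?_)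
    simp [partialDeriv]
  | add x y _ _ hx hy =>
    obtain ⟨φ, h1, h2, h3⟩ := hx
    obtain ⟨ψ, k1, k2, k3⟩ := hy
    refine ⟨φ + ψ, testFields_add h1 k1, ?_, fun i => ?_⟩
    · exact (Lp.coeFn_add _ _).trans (h2.add k2)
    · rw [partialDeriv_add (h1.1.differentiable (by simp)) (k1.1.differentiable (by simp))]
      exact (Lp.coeFn_add _ _).trans ((h3 i).add (k3 i))
  | smul c x _ hx =>
    obtain ⟨φ, h1, h2, h3⟩ := hx
    refine ⟨c • φ, testFields_smul c h1, ?_, fun i => ?_⟩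
    · exact (Lp.coeFn_smul _ _).trans (h2.const_smul c)
    · rw [partialDeriv_smul c (h1.1.differentiable (by simp))]
      exact (Lp.coeFn_smul _ _).trans ((h3 i).const_smul c)

theorem dense_isTest : Dense {u : V Ω | IsTest u} := by
  rw [Subtype.dense_iff]
  intro z hz
  refine closure_mono ?_ (show z ∈ closure (_ : Set (H1Ambient Ω)) from hz)
  intro y hy
  exact ⟨⟨y, subset_closure hy⟩, exists_testField_of_mem_span hy, rfl⟩

/-- Weak continuity is formulated with elements of `H`; this allows it to be tested with elements of
`V`. -/
theorem toField_mem_H (u : V Ω) : toField u ∈ H Ω := by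
  have hcl : IsClosed {u : V Ω | toField u ∈ H Ω} :=
    (Submodule.isClosed_topologicalClosure _).preimage (toFieldL Ω).continuous
  refine dense_isTest.induction (P := fun u => toField u ∈ H Ω) ?_ hcl u
  rintro u ⟨φ, h1, h2, -⟩
  exact Submodule.le_topologicalClosure _ (Submodule.subset_span ⟨φ, h1, h2⟩)

/-! ### Sobolev's inequality, interpolation and Hölder's inequality -/

theorem norm_fderiv_le_sum (φ : E3 → E3) (x : E3) :
    ‖fderiv ℝ φ x‖ ≤ ‖∑ i : Fin 3, ‖partialDeriv i φ x‖‖ := by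
  rw [Real.norm_of_nonneg (Finset.sum_nonneg fun _ _ => norm_nonneg _)]
  refine ContinuousLinearMap.opNorm_le_bound _ (Finset.sum_nonneg fun _ _ => norm_nonneg _) ?_
  intro v
  have hv : v = ∑ i : Fin 3, v i • (EuclideanSpace.single i (1 : ℝ) : E3) := by
    ext k
    simp [Fin.sum_univ_three]
    fin_cases k <;> simp
  conv_lhs => rw [hv]
  rw [map_sum, Finset.sum_mul]
  refine (norm_sum_le _ _).trans (Finset.sum_le_sum fun i _ => ?_)
  rw [map_smul, norm_smul, mul_comm]
  exact mul_le_mul_of_nonneg_left (PiLp.norm_apply_le v i) (norm_nonneg _)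

theorem tsupport_partialDeriv_subset (i : Fin 3) (φ : E3 → E3) :
    tsupport (partialDeriv i φ) ⊆ tsupport φ :=
  tsupport_fderiv_apply_subset ℝ _

/-- The constant of the Sobolev inequality on `V`. -/
def sobolevConst : ℝ :=
  SNormLESNormFDerivOfEqConst E3 (volume : Measure E3) 2 * 3

theorem sobolevConst_nonneg : 0 ≤ sobolevConst := by unfold sobolevConst; positivity

theorem IsTest.eLpNorm_six_le {u : V Ω} (hu : IsTest u) :
    eLpNorm (toField u : E3 → E3) 6 (volume.restrict Ω) ≤
      ENNReal.ofReal (sobolevConst * normV u) := by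
  obtain ⟨φ, ⟨h1, h2, h3, -⟩, h4, h5⟩ := hu
  have hc1 : ContDiff ℝ 1 φ := h1.of_le (by norm_num)
  have hsob := eLpNorm_le_eLpNorm_fderiv_of_eq (volume : Measure E3) hc1 h2
    (p := 2) (p' := 6) (by norm_num) (by simp) (by simp; norm_num)
  rw [eLpNorm_congr_ae h4]
  have hpd : ∀ i, AEStronglyMeasurable (partialDeriv i φ) volume := fun i =>
    ((hc1.continuous_fderiv (by norm_num)).clm_apply continuous_const).aestronglyMeasurable
  have hi : ∀ i, eLpNorm (partialDeriv i φ) 2 volume ≤ ENNReal.ofReal (normV u) := by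
    intro i
    rw [← eLpNorm_restrict_eq_of_support_subset
      ((subset_tsupport _).trans ((tsupport_partialDeriv_subset i φ).trans h3)),
      ← eLpNorm_congr_ae (h5 i)]
    rw [← Lp.enorm_def, ← ofReal_norm]
    exact ENNReal.ofReal_le_ofReal (norm_grad_apply_le u i)
  -- The factor 3 in `sobolevConst` comes from here: the full derivative is bounded by the sum of
  -- three partial derivatives, each at most `normV u` in `L²`.
  have hfd : eLpNorm (fderiv ℝ φ) 2 volume ≤ 3 * ENNReal.ofReal (normV u) := by
    calc eLpNorm (fderiv ℝ φ) 2 volume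
        ≤ eLpNorm (∑ i : Fin 3, fun x => ‖partialDeriv i φ x‖) 2 volume :=
          eLpNorm_mono fun x => by simpa using norm_fderiv_le_sum φ x
      _ ≤ ∑ i : Fin 3, eLpNorm (fun x => ‖partialDeriv i φ x‖) 2 volume :=
          eLpNorm_sum_le (fun i _ => (hpd i).norm) (by norm_num)
      _ ≤ ∑ i : Fin 3, ENNReal.ofReal (normV u) :=
          Finset.sum_le_sum fun i _ => by rw [eLpNorm_norm]; exact hi i
      _ = 3 * ENNReal.ofReal (normV u) := by simp
  calc eLpNorm φ 6 (volume.restrict Ω) ≤ eLpNorm φ 6 volume := eLpNorm_restrict_le _ _ _ _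
    _ ≤ _ := hsob
    _ ≤ SNormLESNormFDerivOfEqConst E3 (volume : Measure E3) 2 * (3 * ENNReal.ofReal (normV u)) := by
        exact mul_le_mul' le_rfl hfd
    _ = ENNReal.ofReal (sobolevConst * normV u) := by
        rw [sobolevConst, ENNReal.ofReal_mul (by positivity), ENNReal.ofReal_mul (by positivity)]
        simp [mul_assoc]

/-- Sobolev's inequality `‖u‖_{L⁶} ≤ C ‖∇u‖_{L²}` on `V`. -/
theorem eLpNorm_six_le (u : V Ω) :
    eLpNorm (toField u : E3 → E3) 6 (volume.restrict Ω) ≤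
      ENNReal.ofReal (sobolevConst * normV u) := by
  have hu : u ∈ closure {u : V Ω | IsTest u} := dense_isTest u
  obtain ⟨z, hz, hlim⟩ := mem_closure_iff_seq_limit.1 hu
  have h1 : Tendsto (fun n => toField (z n)) atTop (𝓝 (toField u)) :=
    ((toFieldL Ω).continuous.tendsto u).comp hlim
  -- `L²` convergence gives a subsequence converging almost everywhere, along which Fatou's lemma
  -- makes the `L⁶` norm lower semicontinuous.
  obtain ⟨ns, hns, hae⟩ := (tendstoInMeasure_of_tendsto_Lp h1).exists_seq_tendsto_ae
  refine (Lp.eLpNorm_lim_le_liminf_eLpNorm (fun n => Lp.aestronglyMeasurable (toField (z (ns n))))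
    _ hae).trans ?_
  have h2 : Tendsto (fun n => ENNReal.ofReal (sobolevConst * normV (z (ns n)))) atTop
      (𝓝 (ENNReal.ofReal (sobolevConst * normV u))) := by
    refine ENNReal.tendsto_ofReal (Tendsto.const_mul _ ?_)
    exact (continuous_normV.tendsto u).comp (hlim.comp hns.tendsto_atTop)
  rw [← h2.liminf_eq]
  exact liminf_le_liminf (Eventually.of_forall fun n => (hz (ns n)).eLpNorm_six_le)

theorem memLp_six (u : V Ω) : MemLp (toField u : E3 → E3) 6 (volume.restrict Ω) :=
  ⟨Lp.aestronglyMeasurable _, (eLpNorm_six_le u).trans_lt ENNReal.ofReal_lt_top⟩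

instance holderTriple_six_three_two : ENNReal.HolderTriple 6 3 2 where
  inv_add_inv_eq_inv := by
    rw [← ENNReal.toReal_eq_toReal_iff' (by simp) (by simp), ENNReal.toReal_add (by simp) (by simp)]
    simp only [ENNReal.toReal_inv, ENNReal.toReal_ofNat]
    norm_num

instance holderTriple_four_twelve_three : ENNReal.HolderTriple 4 12 3 where
  inv_add_inv_eq_inv := by
    rw [← ENNReal.toReal_eq_toReal_iff' (by simp) (by simp), ENNReal.toReal_add (by simp) (by simp)]
    simp only [ENNReal.toReal_inv, ENNReal.toReal_ofNat]
    norm_num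

theorem toReal_eLpNorm_two (g : L2 Ω) :
    (eLpNorm (g : E3 → E3) 2 (volume.restrict Ω)).toReal = ‖g‖ := (Lp.norm_def g).symm

/-- The `L⁶` norm of an element of `V` is controlled by its gradient. -/
theorem toReal_eLpNorm_six_le (u : V Ω) :
    (eLpNorm (toField u : E3 → E3) 6 (volume.restrict Ω)).toReal ≤ sobolevConst * normV u :=
  ENNReal.toReal_le_of_le_ofReal (mul_nonneg sobolevConst_nonneg (normV_nonneg u))
    (eLpNorm_six_le u)

/-- Interpolation of `L³` between `L²` and `L⁶`. -/
theorem eLpNorm_three_le {α E : Type*} [MeasurableSpace α] [NormedAddCommGroup E]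
    {ν : Measure α} {f : α → E} (hf : AEStronglyMeasurable f ν) :
    eLpNorm f 3 ν ≤ eLpNorm f 2 ν ^ (1 / 2 : ℝ) * eLpNorm f 6 ν ^ (1 / 2 : ℝ) := by
  have hm : AEStronglyMeasurable (fun x => ‖f x‖ ^ (1 / 2 : ℝ)) ν :=
    (Real.continuous_rpow_const (by norm_num)).comp_aestronglyMeasurable hf.norm
  -- Hölder for `|f| = |f|^{1/2} |f|^{1/2}` with `1/3 = 1/4 + 1/12`; the `L⁴` and `L¹²` norms of
  -- `|f|^{1/2}` are square roots of the `L²` and `L⁶` norms of `f`.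
  have h := eLpNorm_smul_le_mul_eLpNorm (p := 4) (q := 12) (r := 3) hm hm
  have e : ((fun x => ‖f x‖ ^ (1 / 2 : ℝ)) • fun x => ‖f x‖ ^ (1 / 2 : ℝ)) = fun x => ‖f x‖ := by
    ext x
    simp only [Pi.smul_apply', smul_eq_mul]
    rw [← Real.rpow_add_of_nonneg (norm_nonneg _) (by norm_num) (by norm_num)]
    norm_num
  have e4 : (4 : ℝ≥0∞) * ENNReal.ofReal (1 / 2) = 2 := by
    rw [← ENNReal.toReal_eq_toReal_iff' (by finiteness) (by simp)]
    simp; norm_num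
  have e12 : (12 : ℝ≥0∞) * ENNReal.ofReal (1 / 2) = 6 := by
    rw [← ENNReal.toReal_eq_toReal_iff' (by finiteness) (by simp)]
    simp; norm_num
  rw [e, eLpNorm_norm, eLpNorm_norm_rpow f (by norm_num), eLpNorm_norm_rpow f (by norm_num), e4,
    e12] at h
  exact h

theorem memLp_three (u : V Ω) : MemLp (toField u : E3 → E3) 3 (volume.restrict Ω) := by
  refine ⟨Lp.aestronglyMeasurable _, (eLpNorm_three_le (Lp.aestronglyMeasurable _)).trans_lt ?_⟩
  exact ENNReal.mul_lt_top
    (ENNReal.rpow_lt_top_of_nonneg (by norm_num) (Lp.eLpNorm_ne_top _))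
    (ENNReal.rpow_lt_top_of_nonneg (by norm_num) (memLp_six u).2.ne)

theorem toReal_eLpNorm_three_le (u : V Ω) :
    (eLpNorm (toField u : E3 → E3) 3 (volume.restrict Ω)).toReal ≤
      √(‖toField u‖ * (sobolevConst * normV u)) := by
  have h := ENNReal.toReal_mono (ENNReal.mul_ne_top
    (ENNReal.rpow_ne_top_of_nonneg (by norm_num) (Lp.eLpNorm_ne_top _))
    (ENNReal.rpow_ne_top_of_nonneg (by norm_num) (memLp_six u).2.ne))
    (eLpNorm_three_le (Lp.aestronglyMeasurable (toField u)))
  rw [ENNReal.toReal_mul, ← ENNReal.toReal_rpow, ← ENNReal.toReal_rpow, toReal_eLpNorm_two,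
    ← Real.sqrt_eq_rpow, ← Real.sqrt_eq_rpow, ← Real.sqrt_mul (norm_nonneg _)] at h
  refine h.trans (Real.sqrt_le_sqrt ?_)
  exact mul_le_mul_of_nonneg_left (toReal_eLpNorm_six_le u) (norm_nonneg _)

/-- Hölder's inequality with exponents `6, 2, 3`. -/
theorem integral_norm_mul_three {α E : Type*} [MeasurableSpace α] [NormedAddCommGroup E]
    {ν : Measure α} {f g h : α → E} (hf : MemLp f 6 ν) (hg : MemLp g 2 ν) (hh : MemLp h 3 ν) :
    Integrable (fun x => ‖f x‖ * ‖g x‖ * ‖h x‖) ν ∧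
    ∫ x, ‖f x‖ * ‖g x‖ * ‖h x‖ ∂ν ≤
      (eLpNorm f 6 ν).toReal * (eLpNorm g 2 ν).toReal * (eLpNorm h 3 ν).toReal := by
  have h1 : MemLp ((fun x => ‖f x‖) • fun x => ‖h x‖) 2 ν :=
    MemLp.smul (p := 6) (q := 3) hh.norm hf.norm
  have h2 : MemLp ((fun x => ‖g x‖) • ((fun x => ‖f x‖) • fun x => ‖h x‖)) 1 ν :=
    MemLp.smul (p := 2) (q := 2) h1 hg.norm
  have e : (fun x => ‖f x‖ * ‖g x‖ * ‖h x‖) =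
      (fun x => ‖g x‖) • ((fun x => ‖f x‖) • fun x => ‖h x‖) := by
    ext x; simp only [Pi.smul_apply', Pi.mul_apply, smul_eq_mul]; ring
  have hi : Integrable (fun x => ‖f x‖ * ‖g x‖ * ‖h x‖) ν := by
    rw [e]; exact memLp_one_iff_integrable.1 h2
  refine ⟨hi, ?_⟩
  have h3 := eLpNorm_smul_le_mul_eLpNorm (p := 2) (q := 2) (r := 1) h1.1 hg.norm.1
  have h4 := eLpNorm_smul_le_mul_eLpNorm (p := 6) (q := 3) (r := 2) hh.norm.1 hf.norm.1
  rw [eLpNorm_norm, eLpNorm_norm] at h4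
  rw [eLpNorm_norm] at h3
  have h5 : eLpNorm (fun x => ‖f x‖ * ‖g x‖ * ‖h x‖) 1 ν ≤
      eLpNorm g 2 ν * (eLpNorm f 6 ν * eLpNorm h 3 ν) := by
    rw [e]; exact h3.trans (by gcongr)
  have h6 : ∫ x, ‖f x‖ * ‖g x‖ * ‖h x‖ ∂ν =
      (eLpNorm (fun x => ‖f x‖ * ‖g x‖ * ‖h x‖) 1 ν).toReal := by
    rw [eLpNorm_one_eq_lintegral_enorm, ← integral_norm_eq_lintegral_enorm hi.1]
    exact integral_congr_ae (Eventually.of_forall fun x =>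
      (Real.norm_of_nonneg (by positivity)).symm)
  rw [h6]
  refine (ENNReal.toReal_mono ?_ h5).trans (le_of_eq ?_)
  · exact ENNReal.mul_ne_top hg.2.ne (ENNReal.mul_ne_top hf.2.ne hh.2.ne)
  · rw [ENNReal.toReal_mul, ENNReal.toReal_mul]; ring

/-! ### The trilinear form -/

/-- The integrand of the trilinear form. -/
def bIntegrand (u v w : V Ω) (x : E3) : ℝ :=
  ∑ i : Fin 3, ∑ j : Fin 3,
    (toField u : E3 → E3) x i * (grad v i : E3 → E3) x j * (toField w : E3 → E3) x j

theorem b_eq_integral (u v w : V Ω) : b u v w = ∫ x in Ω, bIntegrand u v w x := rfl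

theorem norm_bIntegrand_le (u v w : V Ω) (x : E3) :
    ‖bIntegrand u v w x‖ ≤ ∑ i : Fin 3,
      ‖(toField u : E3 → E3) x‖ * ‖(grad v i : E3 → E3) x‖ * ‖(toField w : E3 → E3) x‖ := by
  refine (norm_sum_le _ _).trans (Finset.sum_le_sum fun i _ => ?_)
  have e : ∑ j : Fin 3, (toField u : E3 → E3) x i * (grad v i : E3 → E3) x j *
      (toField w : E3 → E3) x j = (toField u : E3 → E3) x i *
        inner ℝ ((grad v i : E3 → E3) x) ((toField w : E3 → E3) x) := by
    simp only [PiLp.inner_apply, Finset.mul_sum, RCLike.inner_apply, conj_trivial]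
    exact Finset.sum_congr rfl fun j _ => by ring
  rw [e, norm_mul, mul_assoc]
  gcongr
  · exact PiLp.norm_apply_le _ i
  · exact norm_inner_le_norm _ _

theorem aestronglyMeasurable_coord (g : L2 Ω) (i : Fin 3) :
    AEStronglyMeasurable (fun x => (g : E3 → E3) x i) (volume.restrict Ω) :=
  (EuclideanSpace.proj (𝕜 := ℝ) i).continuous.comp_aestronglyMeasurable (Lp.aestronglyMeasurable g)

theorem integrable_bIntegrand (u v w : V Ω) :
    Integrable (bIntegrand u v w) (volume.restrict Ω) := by
  refine Integrable.mono' (integrable_finsetSum Finset.univ fun (i : Fin 3) _ =>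
    (integral_norm_mul_three (memLp_six u) (Lp.memLp (grad v i)) (memLp_three w)).1) ?_
    (Eventually.of_forall (norm_bIntegrand_le u v w))
  refine Finset.aestronglyMeasurable_fun_sum _ fun i _ =>
    Finset.aestronglyMeasurable_fun_sum _ fun j _ => ?_
  exact ((aestronglyMeasurable_coord _ i).mul (aestronglyMeasurable_coord _ j)).mul
    (aestronglyMeasurable_coord _ j)

/-- The basic estimate of the trilinear form. -/
theorem abs_b_le (u v w : V Ω) :
    |b u v w| ≤ 3 * sobolevConst * normV u * normV v * √(‖toField w‖ * (sobolevConst * normV w)) := by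
  have h := fun i : Fin 3 =>
    integral_norm_mul_three (memLp_six u) (Lp.memLp (grad v i)) (memLp_three w)
  have hS := sobolevConst_nonneg
  rw [b_eq_integral, ← Real.norm_eq_abs]
  refine (norm_integral_le_of_norm_le (integrable_finsetSum Finset.univ fun i _ => (h i).1)
    (Eventually.of_forall (norm_bIntegrand_le u v w))).trans ?_
  rw [integral_finsetSum _ fun i _ => (h i).1]
  have hi : ∀ i ∈ (Finset.univ : Finset (Fin 3)), _ ≤ sobolevConst * normV u * normV v *
      √(‖toField w‖ * (sobolevConst * normV w)) := fun i _ => by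
    refine (h i).2.trans ?_
    rw [toReal_eLpNorm_two]
    have hu := normV_nonneg u
    have hv := normV_nonneg v
    exact mul_le_mul (mul_le_mul (toReal_eLpNorm_six_le u) (norm_grad_apply_le v i)
      (norm_nonneg _) (mul_nonneg hS hu)) (toReal_eLpNorm_three_le w) ENNReal.toReal_nonneg
      (mul_nonneg (mul_nonneg hS hu) hv)
  refine (Finset.sum_le_card_nsmul _ _ _ hi).trans (le_of_eq ?_)
  simp
  ring

/-- A coarser form of `abs_b_le`, linear in the norm of `w`, which gives boundedness of the
functional `b(u,v,·)` on `V`. -/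
theorem abs_b_le_norm (u v w : V Ω) :
    |b u v w| ≤ 3 * sobolevConst * √sobolevConst * normV u * normV v * ‖w‖ := by
  refine (abs_b_le u v w).trans ?_
  have hS := sobolevConst_nonneg
  have hu := normV_nonneg u
  have hv := normV_nonneg v
  have : √(‖toField w‖ * (sobolevConst * normV w)) ≤ √sobolevConst * ‖w‖ := by
    rw [← Real.sqrt_sq (norm_nonneg w), ← Real.sqrt_mul hS]
    refine Real.sqrt_le_sqrt ?_
    have h1 := norm_toField_le w
    have h2 := normV_le_norm w
    calc ‖toField w‖ * (sobolevConst * normV w) ≤ ‖w‖ * (sobolevConst * ‖w‖) :=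
          mul_le_mul h1 (mul_le_mul_of_nonneg_left h2 hS) (mul_nonneg hS (normV_nonneg w))
            (norm_nonneg w)
      _ = _ := by ring
  calc _ ≤ 3 * sobolevConst * normV u * normV v * (√sobolevConst * ‖w‖) :=
        mul_le_mul_of_nonneg_left this (by positivity)
    _ = _ := by ring

theorem b_add_left (u u' v w : V Ω) : b (u + u') v w = b u v w + b u' v w := by
  simp only [b_eq_integral]
  rw [← integral_add (integrable_bIntegrand _ _ _) (integrable_bIntegrand _ _ _)]
  refine integral_congr_ae ?_
  filter_upwards [Lp.coeFn_add (toField u) (toField u')] with x hx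
  simp only [bIntegrand, toField_add, hx, Pi.add_apply, PiLp.add_apply, add_mul,
    Finset.sum_add_distrib]

theorem b_smul_left (c : ℝ) (u v w : V Ω) : b (c • u) v w = c * b u v w := by
  simp only [b_eq_integral]
  rw [← integral_const_mul]
  refine integral_congr_ae ?_
  filter_upwards [Lp.coeFn_smul c (toField u)] with x hx
  simp only [bIntegrand, toField_smul, hx, Pi.smul_apply, PiLp.smul_apply, smul_eq_mul,
    Finset.mul_sum, mul_assoc]

theorem b_add_mid (u v v' w : V Ω) : b u (v + v') w = b u v w + b u v' w := by
  simp only [b_eq_integral]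
  rw [← integral_add (integrable_bIntegrand _ _ _) (integrable_bIntegrand _ _ _)]
  refine integral_congr_ae ?_
  filter_upwards [ae_all_iff.2 fun i => Lp.coeFn_add (grad v i) (grad v' i)] with x hx
  simp only [bIntegrand, grad_add, PiLp.add_apply, hx, Pi.add_apply, add_mul, mul_add,
    Finset.sum_add_distrib]

theorem b_smul_mid (c : ℝ) (u v w : V Ω) : b u (c • v) w = c * b u v w := by
  simp only [b_eq_integral]
  rw [← integral_const_mul]
  refine integral_congr_ae ?_
  filter_upwards [ae_all_iff.2 fun i => Lp.coeFn_smul c (grad v i)] with x hx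
  simp only [bIntegrand, grad_smul, PiLp.smul_apply, hx, Pi.smul_apply, smul_eq_mul,
    Finset.mul_sum]
  exact Finset.sum_congr rfl fun i _ => Finset.sum_congr rfl fun j _ => by ring

theorem b_add_right (u v w w' : V Ω) : b u v (w + w') = b u v w + b u v w' := by
  simp only [b_eq_integral]
  rw [← integral_add (integrable_bIntegrand _ _ _) (integrable_bIntegrand _ _ _)]
  refine integral_congr_ae ?_
  filter_upwards [Lp.coeFn_add (toField w) (toField w')] with x hx
  simp only [bIntegrand, toField_add, hx, Pi.add_apply, PiLp.add_apply, mul_add,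
    Finset.sum_add_distrib]

theorem b_smul_right (c : ℝ) (u v w : V Ω) : b u v (c • w) = c * b u v w := by
  simp only [b_eq_integral]
  rw [← integral_const_mul]
  refine integral_congr_ae ?_
  filter_upwards [Lp.coeFn_smul c (toField w)] with x hx
  simp only [bIntegrand, toField_smul, hx, Pi.smul_apply, PiLp.smul_apply, smul_eq_mul,
    Finset.mul_sum]
  exact Finset.sum_congr rfl fun i _ => Finset.sum_congr rfl fun j _ => by ring

/-- A bounded trilinear form on a normed space defines a continuous map into the dual. -/
theorem exists_continuous_dual_of_trilinear {X : Type*} [NormedAddCommGroup X] [NormedSpace ℝ X]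
    (B : X → X → X → ℝ) (C : ℝ) (hC : 0 ≤ C)
    (add₁ : ∀ u u' v w, B (u + u') v w = B u v w + B u' v w)
    (smul₁ : ∀ (c : ℝ) u v w, B (c • u) v w = c * B u v w)
    (add₂ : ∀ u v v' w, B u (v + v') w = B u v w + B u v' w)
    (smul₂ : ∀ (c : ℝ) u v w, B u (c • v) w = c * B u v w)
    (add₃ : ∀ u v w w', B u v (w + w') = B u v w + B u v w')
    (smul₃ : ∀ (c : ℝ) u v w, B u v (c • w) = c * B u v w)
    (bound : ∀ u v w, |B u v w| ≤ C * ‖u‖ * ‖v‖ * ‖w‖) :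
    ∃ F : X → X → StrongDual ℝ X, (∀ u v w, F u v w = B u v w) ∧
      Continuous fun p : X × X => F p.1 p.2 := by
  let R : X → X →L[ℝ] X →L[ℝ] ℝ := fun u =>
    LinearMap.mkContinuous₂ (LinearMap.mk₂ ℝ (B u) (add₂ u) (fun c => smul₂ c u)
      (add₃ u) (fun c v w => smul₃ c u v w)) (C * ‖u‖) (fun v w => bound u v w)
  let L : X →ₗ[ℝ] X →L[ℝ] X →L[ℝ] ℝ :=
    { toFun := R
      map_add' := fun u u' => by ext v w; exact add₁ u u' v w
      map_smul' := fun c u => by ext v w; exact smul₁ c u v w }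
  have hb : ∀ u, ‖L u‖ ≤ C * ‖u‖ := fun u =>
    LinearMap.mkContinuous₂_norm_le _ (mul_nonneg hC (norm_nonneg u))
      fun v w => bound u v w
  let F := LinearMap.mkContinuous (𝕜 := ℝ) (𝕜₂ := ℝ) (σ := RingHom.id ℝ) (E := X)
    (F := X →L[ℝ] X →L[ℝ] ℝ) L C hb
  refine ⟨fun u v => F u v, fun u v w => rfl, ?_⟩
  exact (F.continuous.comp continuous_fst).clm_apply continuous_snd

theorem exists_bDual (Ω : Set E3) :
    ∃ F : V Ω → V Ω → StrongDual ℝ (V Ω), (∀ u v w, F u v w = b u v w) ∧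
      Continuous fun p : V Ω × V Ω => F p.1 p.2 := by
  have hS := sobolevConst_nonneg
  refine exists_continuous_dual_of_trilinear b (3 * sobolevConst * √sobolevConst) (by positivity)
    b_add_left b_smul_left b_add_mid b_smul_mid b_add_right b_smul_right fun u v w => ?_
  refine (abs_b_le_norm u v w).trans (mul_le_mul_of_nonneg_right ?_ (norm_nonneg w))
  exact mul_le_mul (mul_le_mul_of_nonneg_left (normV_le_norm u) (by positivity))
    (normV_le_norm v) (normV_nonneg v) (by positivity)

/-- The functional `b(u,v,·)` on `V`. -/
def bDual (u v : V Ω) : StrongDual ℝ (V Ω) := (exists_bDual Ω).choose u v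

theorem bDual_apply (u v w : V Ω) : bDual u v w = b u v w := (exists_bDual Ω).choose_spec.1 u v w

theorem continuous_bDual : Continuous fun p : V Ω × V Ω => bDual p.1 p.2 :=
  (exists_bDual Ω).choose_spec.2

/-- Here `b(u,w,w) = ½ ∑ ∫ φᵢ ∂ᵢ|ψ|²`, and integration by parts moves the derivatives onto `φ`,
whose divergence vanishes. Since `φ` has compact support in `Ω`, one integrates over the whole space
and the boundary of `Ω` plays no role. -/
theorem IsTest.b_self_eq_zero {u w : V Ω} (hu : IsTest u) (hw : IsTest w) : b u w w = 0 := by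
  obtain ⟨φ, ⟨p1, p2, p3, p4⟩, p5, -⟩ := hu
  obtain ⟨ψ, ⟨q1, q2, q3, -⟩, q5, q6⟩ := hw
  have dφ : Differentiable ℝ φ := p1.differentiable (by simp)
  have dψ : Differentiable ℝ ψ := q1.differentiable (by simp)
  have hcoord : ∀ i x, fderiv ℝ (fun y => φ y i) x (EuclideanSpace.single i 1) =
      partialDeriv i φ x i := by
    intro i x
    have := ((EuclideanSpace.proj (𝕜 := ℝ) i).hasFDerivAt (x := φ x)).comp x (dφ x).hasFDerivAt
    rw [show (fun y => φ y i) = (EuclideanSpace.proj (𝕜 := ℝ) i : E3 →L[ℝ] ℝ) ∘ φ from rfl,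
      this.fderiv]
    rfl
  have hsq : ∀ i x, fderiv ℝ (fun y => ‖ψ y‖ ^ 2) x (EuclideanSpace.single i 1) =
      2 * inner ℝ (ψ x) (partialDeriv i ψ x) := by
    intro i x
    rw [((dψ x).hasFDerivAt.norm_sq).fderiv]
    simp [partialDeriv]
  have cφ : ∀ i, ContDiff ℝ ∞ (fun y => φ y i) := fun i =>
    (EuclideanSpace.proj (𝕜 := ℝ) i : E3 →L[ℝ] ℝ).contDiff.comp p1
  have cψ : ContDiff ℝ ∞ (fun y => ‖ψ y‖ ^ 2) := q1.norm_sq ℝ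
  have sφ : ∀ i, HasCompactSupport (fun y => φ y i) := fun i =>
    p2.comp_left (g := fun v : E3 => v i) rfl
  have cdφ : ∀ i, Continuous fun x =>
      fderiv ℝ (fun y => φ y i) x (EuclideanSpace.single i 1) := fun i =>
    ((cφ i).continuous_fderiv (by simp)).clm_apply continuous_const
  have cdψ : ∀ i : Fin 3, Continuous fun x =>
      fderiv ℝ (fun y => ‖ψ y‖ ^ 2) x (EuclideanSpace.single i 1) := fun i =>
    (cψ.continuous_fderiv (by simp)).clm_apply continuous_const
  have i1 : ∀ i, Integrable (fun x =>
      φ x i * fderiv ℝ (fun y => ‖ψ y‖ ^ 2) x (EuclideanSpace.single i 1)) := fun i =>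
    ((cφ i).continuous.mul (cdψ i)).integrable_of_hasCompactSupport (sφ i).mul_right
  have i2 : ∀ i, Integrable (fun x =>
      fderiv ℝ (fun y => φ y i) x (EuclideanSpace.single i 1) * ‖ψ x‖ ^ 2) := fun i =>
    ((cdφ i).mul cψ.continuous).integrable_of_hasCompactSupport
      ((sφ i).fderiv_apply ℝ _).mul_right
  have ibp : ∀ i, ∫ x, φ x i * fderiv ℝ (fun y => ‖ψ y‖ ^ 2) x (EuclideanSpace.single i 1) =
      -∫ x, fderiv ℝ (fun y => φ y i) x (EuclideanSpace.single i 1) * ‖ψ x‖ ^ 2 := fun i =>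
    integral_mul_fderiv_eq_neg_fderiv_mul_of_integrable (i2 i) (i1 i)
      (((cφ i).continuous.mul cψ.continuous).integrable_of_hasCompactSupport (sφ i).mul_right)
      (fun x _ => (cφ i).differentiable (by simp) x) (fun x _ => cψ.differentiable (by simp) x)
  have e1 : b u w w = ∫ x in Ω, ∑ i : Fin 3, (1 / 2) *
      (φ x i * fderiv ℝ (fun y => ‖ψ y‖ ^ 2) x (EuclideanSpace.single i 1)) := by
    rw [b_eq_integral]
    refine integral_congr_ae ?_
    filter_upwards [p5, q5, ae_all_iff.2 q6] with x h1 h2 h3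
    simp only [bIntegrand, h1, h2, h3, hsq, PiLp.inner_apply, RCLike.inner_apply, conj_trivial]
    refine Finset.sum_congr rfl fun i _ => ?_
    simp only [Finset.mul_sum]
    exact Finset.sum_congr rfl fun j _ => by ring
  rw [e1, setIntegral_eq_integral_of_forall_compl_eq_zero, integral_finsetSum _
    (fun i _ => (i1 i).const_mul _)]
  · simp only [integral_const_mul, ibp, hcoord]
    rw [← Finset.mul_sum, Finset.sum_neg_distrib, ← integral_finsetSum]
    · have : ∀ x, ∑ i : Fin 3, partialDeriv i φ x i * ‖ψ x‖ ^ 2 = 0 := fun x => by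
        rw [← Finset.sum_mul, show ∑ i : Fin 3, partialDeriv i φ x i = 0 from p4 x, zero_mul]
      simp [this]
    · intro i _
      simpa only [hcoord] using i2 i
  · intro x hx
    have : φ x = 0 := image_eq_zero_of_notMem_tsupport fun hh => hx (p3 hh)
    simp [this]

theorem b_self_eq_zero (u w : V Ω) : b u w w = 0 := by
  have h1 : ∀ w : V Ω, IsTest w → b u w w = 0 := by
    intro w hw
    refine dense_isTest.induction (P := fun u => b u w w = 0) (fun v hv => hv.b_self_eq_zero hw)
      ?_ u
    simp only [← bDual_apply]
    exact isClosed_eq ((continuous_bDual.comp (continuous_id.prodMk continuous_const)).clm_apply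
      continuous_const) continuous_const
  refine dense_isTest.induction (P := fun w => b u w w = 0) h1 ?_ w
  simp only [← bDual_apply]
  exact isClosed_eq ((continuous_bDual.comp (continuous_const.prodMk continuous_id)).clm_apply
    continuous_id) continuous_const

/-! ### Estimates of the cutoff -/

theorem cutoff_eq {N r : ℝ} (hN : 0 < N) (hr : 0 ≤ r) : cutoff N r = N / max N r := by
  unfold cutoff
  split_ifs with h
  · subst h
    rw [max_eq_left hN.le, div_self hN.ne']
  · have hr' : 0 < r := lt_of_le_of_ne hr (Ne.symm h)
    rcases le_total N r with h1 | h1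
    · rw [max_eq_right h1, min_eq_right ((div_le_one hr').2 h1)]
    · rw [max_eq_left h1, div_self hN.ne', min_eq_left ((one_le_div hr').2 h1)]

theorem cutoff_nonneg {N r : ℝ} (hN : 0 < N) (hr : 0 ≤ r) : 0 ≤ cutoff N r := by
  rw [cutoff_eq hN hr]
  have : 0 < max N r := lt_max_of_lt_left hN
  positivity

theorem cutoff_mul_le {N r : ℝ} (hN : 0 < N) (hr : 0 ≤ r) : cutoff N r * r ≤ N := by
  have hm : 0 < max N r := lt_max_of_lt_left hN
  rw [cutoff_eq hN hr, div_mul_eq_mul_div, div_le_iff₀ hm]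
  exact mul_le_mul_of_nonneg_left (le_max_right _ _) hN.le

/-- Follows from `F_N(r) = N / max N r` and the 1-Lipschitz dependence of the maximum. Keeping both
cutoffs as factors is the point: each can later absorb one factor `p` or `q` through
`cutoff_mul_le`. -/
theorem abs_cutoff_sub_le {N p q : ℝ} (hN : 0 < N) (hp : 0 ≤ p) (hq : 0 ≤ q) :
    |cutoff N p - cutoff N q| ≤ cutoff N p * cutoff N q * |p - q| / N := by
  rw [cutoff_eq hN hp, cutoff_eq hN hq]
  have h1 : 0 < max N p := lt_max_of_lt_left hN
  have h2 : 0 < max N q := lt_max_of_lt_left hN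
  have h3 : N / max N p - N / max N q =
      N / max N p * (N / max N q) * (max N q - max N p) / N := by
    field_simp
  have h4 : |max N q - max N p| ≤ |p - q| := by
    rw [abs_sub_comm p q, max_comm N, max_comm N]
    exact abs_max_sub_max_le_abs q p N
  rw [h3, abs_div, abs_mul, abs_of_pos hN, abs_of_pos (by positivity)]
  gcongr

theorem continuousOn_cutoff {N : ℝ} (hN : 0 < N) : ContinuousOn (cutoff N) (Ici 0) := by
  have : ContinuousOn (fun r => N / max N r) (Ici 0) :=
    (continuous_const.div (by fun_prop) fun r => (lt_max_of_lt_left hN).ne').continuousOn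
  exact this.congr fun r hr => cutoff_eq hN hr

theorem continuous_cutoff_comp {X : Type*} [TopologicalSpace X] {N : ℝ} (hN : 0 < N) {g : X → ℝ}
    (hg : Continuous g) (h0 : ∀ x, 0 ≤ g x) : Continuous fun x => cutoff N (g x) :=
  (continuousOn_cutoff hN).comp_continuous hg h0

/-- With `x = s / r ≤ 1` and `γ ≤ 2`, one has `1 - x^γ ≤ 1 - x² ≤ 2 (1 - x)`. This replaces a mean
value estimate and has no difficulty at small `s`. -/
theorem rpow_sub_rpow_mul_le {γ r s : ℝ} (hγ₂ : γ ≤ 2) (hs : 0 ≤ s) (hsr : s ≤ r) :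
    (r ^ γ - s ^ γ) * r ≤ 2 * r ^ γ * (r - s) := by
  rcases hs.eq_or_lt with rfl | hs
  · have : (0 : ℝ) ≤ 0 ^ γ := Real.rpow_nonneg le_rfl _
    have h2 : 0 ≤ r ^ γ := Real.rpow_nonneg hsr _
    nlinarith [mul_nonneg this hsr, mul_nonneg h2 hsr]
  have hr : 0 < r := hs.trans_le hsr
  have hx1 : s / r ≤ 1 := (div_le_one hr).2 hsr
  have h1 : (s / r) ^ (2 : ℝ) ≤ (s / r) ^ γ :=
    Real.rpow_le_rpow_of_exponent_ge (by positivity) hx1 hγ₂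
  rw [Real.rpow_two, Real.div_rpow hs.le hr.le, le_div_iff₀ (by positivity)] at h1
  have h2 : 0 < r ^ γ := by positivity
  have h3 : r * (s / r) ^ 2 ≥ r - 2 * (r - s) := by
    have : r * (s / r) ^ 2 = s ^ 2 / r := by field_simp
    rw [this, ge_iff_le, le_div_iff₀ hr]
    nlinarith [sq_nonneg (r - s)]
  nlinarith [mul_le_mul_of_nonneg_right h1 hr.le, mul_le_mul_of_nonneg_left h3 h2.le]

/-- The Lipschitz estimate of the cutoff in the damping term. -/
theorem abs_cutoff_rpow_sub_mul_le {N γ r s : ℝ} (hN : 0 < N) (hγ₀ : 0 ≤ γ) (hγ₂ : γ ≤ 2)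
    (hs : 0 ≤ s) (hsr : s ≤ r) :
    |cutoff N (r ^ γ) - cutoff N (s ^ γ)| * s ^ (γ + 1) ≤ 2 * N * (r - s) := by
  have hr : 0 ≤ r := hs.trans hsr
  have hrγ : 0 ≤ r ^ γ := Real.rpow_nonneg hr _
  have hsγ : 0 ≤ s ^ γ := Real.rpow_nonneg hs _
  have hle : s ^ γ ≤ r ^ γ := Real.rpow_le_rpow hs hsr hγ₀
  have h1 := abs_cutoff_sub_le hN hrγ hsγ
  rw [abs_of_nonneg (sub_nonneg.2 hle)] at h1
  have h2 := rpow_sub_rpow_mul_le hγ₂ hs hsr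
  have h3 : (r ^ γ - s ^ γ) * s ≤ 2 * r ^ γ * (r - s) :=
    (mul_le_mul_of_nonneg_left hsr (sub_nonneg.2 hle)).trans h2
  have c1 := cutoff_mul_le hN hrγ
  have c2 := cutoff_mul_le hN hsγ
  have n1 := cutoff_nonneg hN hrγ
  have n2 := cutoff_nonneg hN hsγ
  have n3 : 0 ≤ r - s := sub_nonneg.2 hsr
  rw [Real.rpow_add_one' hs (by linarith)]
  -- Of the two cutoffs left by `abs_cutoff_sub_le`, one absorbs the factor `s ^ γ`, the other the
  -- `r ^ γ` produced by `h3`, each at the price `N`.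
  calc _ ≤ cutoff N (r ^ γ) * cutoff N (s ^ γ) * (r ^ γ - s ^ γ) / N * (s ^ γ * s) :=
        mul_le_mul_of_nonneg_right h1 (mul_nonneg hsγ hs)
    _ = cutoff N (r ^ γ) * (cutoff N (s ^ γ) * s ^ γ) * ((r ^ γ - s ^ γ) * s) / N := by ring
    _ ≤ cutoff N (r ^ γ) * (cutoff N (s ^ γ) * s ^ γ) * (2 * r ^ γ * (r - s)) / N := by
        gcongr
    _ = 2 * (cutoff N (r ^ γ) * r ^ γ) * (cutoff N (s ^ γ) * s ^ γ) * (r - s) / N := by ring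
    _ ≤ 2 * N * N * (r - s) / N := by gcongr
    _ = 2 * N * (r - s) := by field_simp

/-! ### Pointwise inequalities for `a ↦ |a|^γ a` -/

section Power

variable {E : Type*} [NormedAddCommGroup E] [InnerProductSpace ℝ E]

/-- Cauchy–Schwarz bounds the pairing below by `(‖a‖^γ ‖a‖ - ‖c‖^γ ‖c‖) (‖a‖ - ‖c‖)`, whose factors
have the same sign. -/
theorem inner_power_sub_nonneg {γ : ℝ} (hγ : 0 ≤ γ) (a c : E) :
    0 ≤ inner ℝ (‖a‖ ^ γ • a - ‖c‖ ^ γ • c) (a - c) := by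
  have e : inner ℝ (‖a‖ ^ γ • a - ‖c‖ ^ γ • c) (a - c) =
      ‖a‖ ^ γ * ‖a‖ ^ 2 + ‖c‖ ^ γ * ‖c‖ ^ 2 - (‖a‖ ^ γ + ‖c‖ ^ γ) * inner ℝ a c := by
    simp only [inner_sub_left, inner_sub_right, real_inner_smul_left, real_inner_self_eq_norm_sq]
    rw [real_inner_comm a c]
    ring
  rw [e]
  have h1 := real_inner_le_norm a c
  have hA : 0 ≤ ‖a‖ ^ γ := by positivity
  have hC : 0 ≤ ‖c‖ ^ γ := by positivity
  have h2 := mul_le_mul_of_nonneg_left h1 (add_nonneg hA hC)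
  have h3 : 0 ≤ (‖a‖ ^ γ * ‖a‖ - ‖c‖ ^ γ * ‖c‖) * (‖a‖ - ‖c‖) := by
    rcases le_total ‖a‖ ‖c‖ with h | h
    · have hp := Real.rpow_le_rpow (norm_nonneg a) h hγ
      have := mul_le_mul hp h (norm_nonneg a) hC
      exact mul_nonneg_of_nonpos_of_nonpos (by linarith) (by linarith)
    · have hp := Real.rpow_le_rpow (norm_nonneg c) h hγ
      have := mul_le_mul hp h (norm_nonneg c) hA
      exact mul_nonneg (by linarith) (by linarith)
  nlinarith

theorem rpow_le_one_add_sq {γ x : ℝ} (hγ₀ : 0 ≤ γ) (hγ₂ : γ ≤ 2) (hx : 0 ≤ x) :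
    x ^ γ ≤ 1 + x ^ 2 := by
  rcases le_total x 1 with h | h
  · have := Real.rpow_le_one hx h hγ₀
    nlinarith [sq_nonneg x]
  · have := Real.rpow_le_rpow_of_exponent_le h hγ₂
    rw [Real.rpow_two] at this
    linarith

/-- For `‖c‖ ≤ ‖a‖` split into `‖a‖^γ (a - c)` and `(‖a‖^γ - ‖c‖^γ) c`; the second is controlled by
`rpow_sub_rpow_mul_le` after enlarging `‖c‖` to `‖a‖`. The quadratic weight is chosen to lie in `L³`
for fields in `L⁶`. -/
theorem norm_power_sub_le {γ : ℝ} (hγ₀ : 0 ≤ γ) (hγ₂ : γ ≤ 2) (a c : E) :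
    ‖‖a‖ ^ γ • a - ‖c‖ ^ γ • c‖ ≤ 3 * (1 + ‖a‖ ^ 2 + ‖c‖ ^ 2) * ‖a - c‖ := by
  wlog h : ‖c‖ ≤ ‖a‖ generalizing a c
  · have := this c a (le_of_not_ge h)
    rw [norm_sub_rev, norm_sub_rev a c]
    linarith
  have hp := Real.rpow_le_rpow (norm_nonneg c) h hγ₀
  have h0 : 0 ≤ ‖a‖ ^ γ := by positivity
  have e : ‖a‖ ^ γ • a - ‖c‖ ^ γ • c = ‖a‖ ^ γ • (a - c) + (‖a‖ ^ γ - ‖c‖ ^ γ) • c := by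
    module
  have h1 : ‖a‖ - ‖c‖ ≤ ‖a - c‖ := norm_sub_norm_le a c
  have h2 : (‖a‖ ^ γ - ‖c‖ ^ γ) * ‖c‖ ≤ 2 * ‖a‖ ^ γ * ‖a - c‖ :=
    ((mul_le_mul_of_nonneg_left h (sub_nonneg.2 hp)).trans
      (rpow_sub_rpow_mul_le hγ₂ (norm_nonneg c) h)).trans
      (mul_le_mul_of_nonneg_left h1 (by positivity))
  have h3 := rpow_le_one_add_sq hγ₀ hγ₂ (norm_nonneg a)
  rw [e]
  calc _ ≤ ‖‖a‖ ^ γ • (a - c)‖ + ‖(‖a‖ ^ γ - ‖c‖ ^ γ) • c‖ := norm_add_le _ _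
    _ = ‖a‖ ^ γ * ‖a - c‖ + (‖a‖ ^ γ - ‖c‖ ^ γ) * ‖c‖ := by
        rw [norm_smul, norm_smul, Real.norm_of_nonneg h0, Real.norm_of_nonneg (sub_nonneg.2 hp)]
    _ ≤ 3 * ‖a‖ ^ γ * ‖a - c‖ := by linarith
    _ ≤ 3 * (1 + ‖a‖ ^ 2 + ‖c‖ ^ 2) * ‖a - c‖ := by
        gcongr
        nlinarith [sq_nonneg ‖c‖]

end Power

/-! ### The damping term as a continuous map from `V` to `L²` -/

/-- The damping term `|u|^{β-1} u` as a function. -/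
def dampFun (β : ℝ) (u : V Ω) (x : E3) : E3 :=
  ‖(toField u : E3 → E3) x‖ ^ (β - 1) • (toField u : E3 → E3) x

theorem aestronglyMeasurable_dampFun {β : ℝ} (hβ : 1 ≤ β) (u : V Ω) :
    AEStronglyMeasurable (dampFun β u) (volume.restrict Ω) := by
  have hm := Lp.aestronglyMeasurable (toField u)
  exact ((Real.continuous_rpow_const (by linarith)).comp_aestronglyMeasurable hm.norm).smul hm

theorem norm_dampFun {β : ℝ} (hβ : 1 ≤ β) (u : V Ω) (x : E3) :
    ‖dampFun β u x‖ = ‖(toField u : E3 → E3) x‖ ^ β := by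
  rw [dampFun, norm_smul, Real.norm_of_nonneg (by positivity),
    ← Real.rpow_add_one' (norm_nonneg _) (by linarith), sub_add_cancel]

/-- A constant for the bound of the damping term in `L²`. -/
def dampConst (Ω : Set E3) (β : ℝ) : ℝ :=
  (sobolevConst * ((volume.restrict Ω) univ ^
    (1 / (2 * ENNReal.ofReal β).toReal - 1 / (6 : ℝ≥0∞).toReal)).toReal) ^ β

theorem dampConst_nonneg (Ω : Set E3) (β : ℝ) : 0 ≤ dampConst Ω β :=
  Real.rpow_nonneg (mul_nonneg sobolevConst_nonneg ENNReal.toReal_nonneg) _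

/-- The `L²` norm of `|u|^β` is the `β`-th power of the `L^{2β}` norm of `u`. As `2β ≤ 6` and `Ω`
has finite measure, the `L⁶` bound of Sobolev suffices. -/
theorem eLpNorm_dampFun_le [IsFiniteMeasure (volume.restrict Ω)] {β : ℝ} (hβ₁ : 1 ≤ β)
    (hβ₃ : β ≤ 3) (u : V Ω) :
    eLpNorm (dampFun β u) 2 (volume.restrict Ω) ≤
      ENNReal.ofReal (dampConst Ω β * normV u ^ β) := by
  have hβ0 : 0 < β := by linarith
  have e1 : eLpNorm (dampFun β u) 2 (volume.restrict Ω) =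
      eLpNorm (fun x => ‖(toField u : E3 → E3) x‖ ^ β) 2 (volume.restrict Ω) :=
    eLpNorm_congr_norm_ae (Eventually.of_forall fun x => by
      rw [norm_dampFun hβ₁, Real.norm_of_nonneg (by positivity)])
  rw [e1, eLpNorm_norm_rpow _ hβ0]
  have hle : 2 * ENNReal.ofReal β ≤ 6 := by
    calc 2 * ENNReal.ofReal β ≤ 2 * ENNReal.ofReal 3 := by gcongr
      _ = 6 := by simp; norm_num
  have hexp : 0 ≤ 1 / (2 * ENNReal.ofReal β).toReal - 1 / (6 : ℝ≥0∞).toReal := by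
    rw [ENNReal.toReal_mul, ENNReal.toReal_ofReal hβ0.le, ENNReal.toReal_ofNat,
      ENNReal.toReal_ofNat, sub_nonneg]
    exact one_div_le_one_div_of_le (by linarith) (by linarith)
  have h1 := eLpNorm_le_eLpNorm_mul_rpow_measure_univ hle
    (Lp.aestronglyMeasurable (toField u))
  have hfin : (volume.restrict Ω) univ ^
      (1 / (2 * ENNReal.ofReal β).toReal - 1 / (6 : ℝ≥0∞).toReal) ≠ ⊤ :=
    ENNReal.rpow_ne_top_of_nonneg hexp (measure_ne_top _ _)
  have h2 : eLpNorm (toField u : E3 → E3) (2 * ENNReal.ofReal β) (volume.restrict Ω) ≤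
      ENNReal.ofReal ((sobolevConst * ((volume.restrict Ω) univ ^
        (1 / (2 * ENNReal.ofReal β).toReal - 1 / (6 : ℝ≥0∞).toReal)).toReal) * normV u) := by
    refine h1.trans ?_
    rw [mul_right_comm, ENNReal.ofReal_mul (mul_nonneg sobolevConst_nonneg (normV_nonneg u)),
      ENNReal.ofReal_toReal hfin]
    exact mul_le_mul' (eLpNorm_six_le u) le_rfl
  have hn : 0 ≤ sobolevConst * ((volume.restrict Ω) univ ^
        (1 / (2 * ENNReal.ofReal β).toReal - 1 / (6 : ℝ≥0∞).toReal)).toReal :=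
    mul_nonneg sobolevConst_nonneg ENNReal.toReal_nonneg
  refine (ENNReal.rpow_le_rpow h2 hβ0.le).trans (le_of_eq ?_)
  rw [ENNReal.ofReal_rpow_of_nonneg (mul_nonneg hn (normV_nonneg u)) hβ0.le,
    Real.mul_rpow hn (normV_nonneg u), dampConst]

theorem memLp_dampFun [IsFiniteMeasure (volume.restrict Ω)] {β : ℝ} (hβ₁ : 1 ≤ β)
    (hβ₃ : β ≤ 3) (u : V Ω) : MemLp (dampFun β u) 2 (volume.restrict Ω) :=
  ⟨aestronglyMeasurable_dampFun hβ₁ u,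
    (eLpNorm_dampFun_le hβ₁ hβ₃ u).trans_lt ENNReal.ofReal_lt_top⟩

open Classical in
/-- The damping term `|u|^{β-1} u` as an element of `(L²(Ω))³`. -/
def dampField (β : ℝ) (u : V Ω) : L2 Ω :=
  -- The value `0` never occurs for `1 ≤ β ≤ 3` on a set of finite measure, by `memLp_dampFun`.
  if h : MemLp (dampFun β u) 2 (volume.restrict Ω) then h.toLp _ else 0

section

variable [IsFiniteMeasure (volume.restrict Ω)] {β : ℝ}

theorem dampField_eq (hβ₁ : 1 ≤ β) (hβ₃ : β ≤ 3) (u : V Ω) :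
    dampField β u = (memLp_dampFun hβ₁ hβ₃ u).toLp _ :=
  dif_pos _

theorem coeFn_dampField (hβ₁ : 1 ≤ β) (hβ₃ : β ≤ 3) (u : V Ω) :
    (dampField β u : E3 → E3) =ᵐ[volume.restrict Ω] dampFun β u := by
  rw [dampField_eq hβ₁ hβ₃]
  exact MemLp.coeFn_toLp _

theorem norm_dampField_le (hβ₁ : 1 ≤ β) (hβ₃ : β ≤ 3) (u : V Ω) :
    ‖dampField β u‖ ≤ dampConst Ω β * normV u ^ β := by
  rw [dampField_eq hβ₁ hβ₃, Lp.norm_toLp]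
  exact ENNReal.toReal_le_of_le_ofReal (mul_nonneg (dampConst_nonneg Ω β)
    (Real.rpow_nonneg (normV_nonneg u) _)) (eLpNorm_dampFun_le hβ₁ hβ₃ u)

theorem inner_dampField (hβ₁ : 1 ≤ β) (hβ₃ : β ≤ 3) (u w : V Ω) :
    inner ℝ (dampField β u) (toField w) = damping β u w := by
  rw [L2.inner_def, damping]
  refine integral_congr_ae ?_
  filter_upwards [coeFn_dampField hβ₁ hβ₃ u] with x hx
  rw [hx, dampFun, real_inner_smul_left]

theorem inner_dampField_sub_nonneg (hβ₁ : 1 ≤ β) (hβ₃ : β ≤ 3) (u v : V Ω) :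
    0 ≤ inner ℝ (dampField β u - dampField β v) (toField (u - v)) := by
  rw [L2.inner_def]
  refine integral_nonneg_of_ae ?_
  filter_upwards [coeFn_dampField hβ₁ hβ₃ u, coeFn_dampField hβ₁ hβ₃ v,
    Lp.coeFn_sub (dampField β u) (dampField β v), Lp.coeFn_sub (toField u) (toField v)]
    with x h1 h2 h3 h4
  rw [toField_sub, h3, h4, Pi.sub_apply, Pi.sub_apply, h1, h2]
  exact inner_power_sub_nonneg (by linarith) _ _

/-- Hölder with exponents 6 and 3 applied to `norm_power_sub_le`. It serves to prove continuity of
the damping term on `V`, hence measurability in time of `A (U t)`. -/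
theorem norm_dampField_sub_le (hβ₁ : 1 ≤ β) (hβ₃ : β ≤ 3) (u v : V Ω) :
    ‖dampField β u - dampField β v‖ ≤
      3 * ((eLpNorm (fun _ : E3 => (1 : ℝ)) 3 (volume.restrict Ω)).toReal +
        (sobolevConst * normV u) ^ 2 + (sobolevConst * normV v) ^ 2) *
        (sobolevConst * normV (u - v)) := by
  have h6 := memLp_six u
  have h6' := memLp_six v
  have hm1 : AEStronglyMeasurable (fun x => ‖(toField u : E3 → E3) x‖ ^ (2 : ℝ))
      (volume.restrict Ω) :=
    (Real.continuous_rpow_const (by norm_num)).comp_aestronglyMeasurable h6.1.norm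
  have hm2 : AEStronglyMeasurable (fun x => ‖(toField v : E3 → E3) x‖ ^ (2 : ℝ))
      (volume.restrict Ω) :=
    (Real.continuous_rpow_const (by norm_num)).comp_aestronglyMeasurable h6'.1.norm
  have e6 : (3 : ℝ≥0∞) * ENNReal.ofReal 2 = 6 := by simp; norm_num
  set q : E3 → ℝ := ((fun _ => (1 : ℝ)) + fun x => ‖(toField u : E3 → E3) x‖ ^ (2 : ℝ)) +
    fun x => ‖(toField v : E3 → E3) x‖ ^ (2 : ℝ) with hq
  have hqm : AEStronglyMeasurable q (volume.restrict Ω) :=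
    (aestronglyMeasurable_const.add hm1).add hm2
  have hq3 : eLpNorm q 3 (volume.restrict Ω) ≤
      eLpNorm (fun _ : E3 => (1 : ℝ)) 3 (volume.restrict Ω) +
      eLpNorm (toField u : E3 → E3) 6 (volume.restrict Ω) ^ (2 : ℝ) +
      eLpNorm (toField v : E3 → E3) 6 (volume.restrict Ω) ^ (2 : ℝ) := by
    refine (eLpNorm_add_le (aestronglyMeasurable_const.add hm1) hm2 (by norm_num)).trans ?_
    refine add_le_add ((eLpNorm_add_le aestronglyMeasurable_const hm1 (by norm_num)).trans ?_) ?_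
    · rw [eLpNorm_norm_rpow _ (by norm_num), e6]
    · rw [eLpNorm_norm_rpow _ (by norm_num), e6]
  have hdm : AEStronglyMeasurable (toField (u - v) : E3 → E3) (volume.restrict Ω) :=
    Lp.aestronglyMeasurable _
  have hmain : eLpNorm (dampField β u - dampField β v : L2 Ω) 2 (volume.restrict Ω) ≤
      ENNReal.ofReal 3 * (eLpNorm (toField (u - v) : E3 → E3) 6 (volume.restrict Ω) *
        eLpNorm q 3 (volume.restrict Ω)) := by
    have h1 := eLpNorm_smul_le_mul_eLpNorm (p := 6) (q := 3) (r := 2) hqm hdm.norm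
    rw [eLpNorm_norm] at h1
    refine le_trans ?_ (mul_le_mul' le_rfl h1)
    refine eLpNorm_le_mul_eLpNorm_of_ae_le_mul ?_ 2
    filter_upwards [coeFn_dampField hβ₁ hβ₃ u, coeFn_dampField hβ₁ hβ₃ v,
      Lp.coeFn_sub (dampField β u) (dampField β v), Lp.coeFn_sub (toField u) (toField v)]
      with x k1 k2 k3 k4
    rw [k3, Pi.sub_apply, k1, k2]
    refine (norm_power_sub_le (by linarith) (by linarith) _ _).trans (le_of_eq ?_)
    simp only [Pi.smul_apply', smul_eq_mul, hq, Pi.add_apply, toField_sub, k4, Pi.sub_apply,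
      Real.rpow_two]
    rw [Real.norm_of_nonneg (by positivity)]
    ring
  have f1 : eLpNorm (fun _ : E3 => (1 : ℝ)) 3 (volume.restrict Ω) ≠ ⊤ :=
    (memLp_const (1 : ℝ)).2.ne
  have f2 : eLpNorm (toField u : E3 → E3) 6 (volume.restrict Ω) ^ (2 : ℝ) ≠ ⊤ :=
    ENNReal.rpow_ne_top_of_nonneg (by norm_num) h6.2.ne
  have f3 : eLpNorm (toField v : E3 → E3) 6 (volume.restrict Ω) ^ (2 : ℝ) ≠ ⊤ :=
    ENNReal.rpow_ne_top_of_nonneg (by norm_num) h6'.2.ne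
  have hfin := ENNReal.add_ne_top.2 ⟨ENNReal.add_ne_top.2 ⟨f1, f2⟩, f3⟩
  have hq3' := ENNReal.toReal_mono hfin hq3
  rw [ENNReal.toReal_add (ENNReal.add_ne_top.2 ⟨f1, f2⟩) f3, ENNReal.toReal_add f1 f2,
    ← ENNReal.toReal_rpow, ← ENNReal.toReal_rpow, Real.rpow_two, Real.rpow_two] at hq3'
  have hmain' := ENNReal.toReal_mono (ENNReal.mul_ne_top ENNReal.ofReal_ne_top
    (ENNReal.mul_ne_top (memLp_six (u - v)).2.ne (hq3.trans_lt hfin.lt_top).ne)) hmain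
  rw [ENNReal.toReal_mul, ENNReal.toReal_mul, ENNReal.toReal_ofReal (by norm_num)] at hmain'
  rw [Lp.norm_def]
  refine hmain'.trans ?_
  have s1 := toReal_eLpNorm_six_le u
  have s2 := toReal_eLpNorm_six_le v
  have s3 := toReal_eLpNorm_six_le (u - v)
  have t1 := pow_le_pow_left₀ ENNReal.toReal_nonneg s1 2
  have t2 := pow_le_pow_left₀ ENNReal.toReal_nonneg s2 2
  have hS : 0 ≤ sobolevConst * normV (u - v) := mul_nonneg sobolevConst_nonneg (normV_nonneg _)
  have hq3'' := hq3'.trans (add_le_add (add_le_add le_rfl t1) t2)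
  have := mul_le_mul s3 hq3'' ENNReal.toReal_nonneg hS
  linarith

theorem continuous_dampField (hβ₁ : 1 ≤ β) (hβ₃ : β ≤ 3) :
    Continuous (dampField β : V Ω → L2 Ω) := by
  refine continuous_iff_continuousAt.2 fun v => ?_
  rw [ContinuousAt, tendsto_iff_norm_sub_tendsto_zero]
  refine squeeze_zero (fun _ => norm_nonneg _) (fun u => norm_dampField_sub_le hβ₁ hβ₃ u v) ?_
  have hc : Continuous fun u : V Ω =>
      3 * ((eLpNorm (fun _ : E3 => (1 : ℝ)) 3 (volume.restrict Ω)).toReal +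
        (sobolevConst * normV u) ^ 2 + (sobolevConst * normV v) ^ 2) *
        (sobolevConst * normV (u - v)) := by
    have h1 : Continuous (normV : V Ω → ℝ) := continuous_normV
    have h2 : Continuous fun u : V Ω => normV (u - v) :=
      h1.comp (continuous_id.sub continuous_const)
    exact (continuous_const.mul ((continuous_const.add ((continuous_const.mul h1).pow 2)).add
      continuous_const)).mul (continuous_const.mul h2)
  have := hc.tendsto v
  have h0 : normV (v - v) = 0 := by
    rw [sub_self]; exact norm_zero
  simpa only [h0, mul_zero] using this

end

/-! ### The nonlinear operator: linear growth and one-sided bound -/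

/-- The nonlinear operator `u ↦ μ((u,·)) + b_N(u,u,·) + α F_N(‖u‖^{β-1}) (|u|^{β-1}u,·)`. -/
def operator (μ α β N : ℝ) (u : V Ω) : StrongDual ℝ (V Ω) :=
  μ • (innerSL ℝ (grad u)).comp (gradL Ω) + cutoff N (normV u) • bDual u u +
    (α * cutoff N (normV u ^ (β - 1))) • (innerSL ℝ (dampField β u)).comp (toFieldL Ω)

theorem normV_sub_comm (u v : V Ω) : normV (u - v) = normV (v - u) := by
  rw [normV, normV, grad_sub, grad_sub, norm_sub_rev]

theorem abs_normV_sub_le (u v : V Ω) : |normV u - normV v| ≤ normV (u - v) := by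
  rw [normV, normV, normV, grad_sub]
  exact abs_norm_sub_norm_le _ _

/-- The scalar core of `abs_bN_sub_le`, with `r = ‖u‖`, `s = ‖v‖`, `n = ‖u - v‖`. In the first term
`F_N(r)` absorbs `r`; in the second the two cutoffs in the Lipschitz estimate absorb `r` and `s`.
Each term contributes half of the constant 6. -/
theorem abs_cutoff_mul_add_le {N S r s n Q x y : ℝ} (hN : 0 < N) (hS : 0 ≤ S) (hr : 0 ≤ r)
    (hs : 0 ≤ s) (hn : |r - s| ≤ n) (hQ : 0 ≤ Q) (hx : |x| ≤ 3 * S * n * r * Q)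
    (hy : |y| ≤ 3 * S * s * r * Q) :
    |cutoff N r * x + (cutoff N r - cutoff N s) * y| ≤ 6 * S * N * n * Q := by
  have hn0 : 0 ≤ n := (abs_nonneg _).trans hn
  have c1 := cutoff_mul_le hN hr
  have c2 := cutoff_mul_le hN hs
  have n1 := cutoff_nonneg hN hr
  have n2 := cutoff_nonneg hN hs
  have d1 : |cutoff N r - cutoff N s| * (s * r) ≤ N * n := by
    calc _ ≤ cutoff N r * cutoff N s * |r - s| / N * (s * r) :=
          mul_le_mul_of_nonneg_right (abs_cutoff_sub_le hN hr hs) (mul_nonneg hs hr)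
      _ = (cutoff N r * r) * (cutoff N s * s) * |r - s| / N := by ring
      _ ≤ N * N * n / N := by
          refine div_le_div_of_nonneg_right ?_ hN.le
          exact mul_le_mul (mul_le_mul c1 c2 (mul_nonneg n2 hs) hN.le) hn
            (abs_nonneg _) (mul_nonneg hN.le hN.le)
      _ = N * n := by field_simp
  refine (abs_add_le _ _).trans ?_
  rw [abs_mul, abs_mul, abs_of_nonneg n1]
  have t1 : cutoff N r * |x| ≤ 3 * S * N * n * Q := by
    calc _ ≤ cutoff N r * (3 * S * n * r * Q) := mul_le_mul_of_nonneg_left hx n1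
      _ = (3 * S * n * Q) * (cutoff N r * r) := by ring
      _ ≤ (3 * S * n * Q) * N := mul_le_mul_of_nonneg_left c1 (by positivity)
      _ = _ := by ring
  have t2 : |cutoff N r - cutoff N s| * |y| ≤ 3 * S * N * n * Q := by
    calc _ ≤ |cutoff N r - cutoff N s| * (3 * S * s * r * Q) :=
          mul_le_mul_of_nonneg_left hy (abs_nonneg _)
      _ = (3 * S * Q) * (|cutoff N r - cutoff N s| * (s * r)) := by ring
      _ ≤ (3 * S * Q) * (N * n) := mul_le_mul_of_nonneg_left d1 (by positivity)
      _ = _ := by ring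
  linarith

/-- The estimate of the difference of the convection terms. -/
theorem abs_bN_sub_le {N : ℝ} (hN : 0 < N) (u v : V Ω) :
    |bN N u u (u - v) - bN N v v (u - v)| ≤ 6 * sobolevConst * N * normV (u - v) *
      √(‖toField (u - v)‖ * (sobolevConst * normV (u - v))) := by
  have e1 : b u u (u - v) = b (u - v) u (u - v) + b v u (u - v) := by
    rw [← b_add_left, sub_add_cancel]
  have e2 : b v u (u - v) = b v v (u - v) := by
    have h := b_add_mid v (u - v) v (u - v)
    rw [sub_add_cancel, b_self_eq_zero, zero_add] at h
    exact h
  -- The factor `b v u` is kept in place of the equal `b v v`, so that its bound `‖v‖ ‖u‖` matches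
  -- the product of the two different cutoffs.
  have e : bN N u u (u - v) - bN N v v (u - v) =
      cutoff N (normV u) * b (u - v) u (u - v) +
        (cutoff N (normV u) - cutoff N (normV v)) * b v u (u - v) := by
    rw [bN, bN, e1, ← e2]
    ring
  rw [e]
  exact abs_cutoff_mul_add_le hN sobolevConst_nonneg (normV_nonneg u) (normV_nonneg v)
    (abs_normV_sub_le u v) (Real.sqrt_nonneg _) (abs_b_le _ _ _) (abs_b_le _ _ _)

/-- The elementary inequality behind the absorption of the nonlinear terms. -/
theorem exists_absorption_const {μ : ℝ} (hμ : 0 < μ) (A B S : ℝ) (hA : 0 ≤ A) (hS : 0 ≤ S) :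
    ∃ C : ℝ, ∀ x y : ℝ, 0 ≤ x → 0 ≤ y →
      A * x * √(y * (S * x)) + B * x * y ≤ μ * x ^ 2 + C * y ^ 2 := by
  -- Half of `μ` is spent on the term `A ε x²`, the other half on the mixed term `K x y`. The
  -- denominator `A + 1` covers `A = 0`.
  set ε := μ / (2 * (A + 1)) with hε
  have hε0 : 0 < ε := by positivity
  have hAε : A * ε ≤ μ / 2 := by
    rw [hε, mul_div_assoc', div_le_div_iff₀ (by positivity) (by norm_num)]
    nlinarith
  set K := A * S / (4 * ε) + B with hK
  refine ⟨K ^ 2 / (2 * μ), fun x y hx hy => ?_⟩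
  have h1 : √(y * (S * x)) ≤ ε * x + S * y / (4 * ε) := by
    rw [Real.sqrt_le_left (by positivity)]
    have h2 : ε * x * (S * y / (4 * ε)) = S * x * y / 4 := by field_simp
    nlinarith [sq_nonneg (ε * x - S * y / (4 * ε))]
  have h3 : A * x * √(y * (S * x)) ≤ A * x * (ε * x + S * y / (4 * ε)) :=
    mul_le_mul_of_nonneg_left h1 (mul_nonneg hA hx)
  have h4 : A * x * (ε * x + S * y / (4 * ε)) + B * x * y = A * ε * x ^ 2 + K * x * y := by
    rw [hK]; ring
  have h5 : A * ε * x ^ 2 ≤ μ / 2 * x ^ 2 := mul_le_mul_of_nonneg_right hAε (sq_nonneg x)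
  have h6 : K * x * y ≤ μ / 2 * x ^ 2 + K ^ 2 / (2 * μ) * y ^ 2 := by
    have : μ / 2 * x ^ 2 + K ^ 2 / (2 * μ) * y ^ 2 - K * x * y =
        (μ * x - K * y) ^ 2 / (2 * μ) := by
      field_simp
      ring
    have h7 : 0 ≤ (μ * x - K * y) ^ 2 / (2 * μ) := by positivity
    linarith
  linarith

section

variable [IsFiniteMeasure (volume.restrict Ω)] {μ α β N : ℝ}

theorem operator_apply (hβ₁ : 1 ≤ β) (hβ₃ : β ≤ 3) (u w : V Ω) :
    operator μ α β N u w = μ * innerV u w + bN N u u w +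
      α * (cutoff N (normV u ^ (β - 1)) * damping β u w) := by
  rw [← inner_dampField hβ₁ hβ₃, operator, bN, innerV, ← bDual_apply, ← mul_assoc]
  rfl

theorem continuous_operator (hβ₁ : 1 ≤ β) (hβ₃ : β ≤ 3) (hN : 0 < N) :
    Continuous (operator μ α β N : V Ω → StrongDual ℝ (V Ω)) := by
  have h1 : Continuous fun u : V Ω => (innerSL ℝ (grad u)).comp (gradL Ω) :=
    ((innerSL ℝ).continuous.comp (gradL Ω).continuous).clm_comp continuous_const
  have h2 : Continuous fun u : V Ω => bDual u u :=
    continuous_bDual.comp (continuous_id.prodMk continuous_id)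
  have h3 : Continuous fun u : V Ω => (innerSL ℝ (dampField β u)).comp (toFieldL Ω) :=
    ((innerSL ℝ).continuous.comp (continuous_dampField hβ₁ hβ₃)).clm_comp continuous_const
  have h4 : Continuous fun u : V Ω => cutoff N (normV u) :=
    continuous_cutoff_comp hN continuous_normV normV_nonneg
  have h5 : Continuous fun u : V Ω => cutoff N (normV u ^ (β - 1)) :=
    continuous_cutoff_comp hN (continuous_normV.rpow_const fun _ => Or.inr (by linarith))
      fun u => Real.rpow_nonneg (normV_nonneg u) _
  exact ((h1.const_smul μ).add (h4.smul h2)).add ((continuous_const.mul h5).smul h3)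

theorem cutoff_mul_norm_dampField_le (hβ₁ : 1 ≤ β) (hβ₃ : β ≤ 3) (hN : 0 < N) (u : V Ω) :
    cutoff N (normV u ^ (β - 1)) * ‖dampField β u‖ ≤ N * dampConst Ω β * normV u := by
  have hr := normV_nonneg u
  have hp : 0 ≤ normV u ^ (β - 1) := Real.rpow_nonneg hr _
  have e : normV u ^ β = normV u ^ (β - 1) * normV u := by
    rw [← Real.rpow_add_one' hr (by linarith), sub_add_cancel]
  have hD := dampConst_nonneg Ω β
  calc _ ≤ cutoff N (normV u ^ (β - 1)) * (dampConst Ω β * normV u ^ β) :=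
        mul_le_mul_of_nonneg_left (norm_dampField_le hβ₁ hβ₃ u) (cutoff_nonneg hN hp)
    _ = (cutoff N (normV u ^ (β - 1)) * normV u ^ (β - 1)) * (dampConst Ω β * normV u) := by
        rw [e]; ring
    _ ≤ N * (dampConst Ω β * normV u) :=
        mul_le_mul_of_nonneg_right (cutoff_mul_le hN hp) (mul_nonneg hD hr)
    _ = _ := by ring

/-- The operator has at most linear growth. -/
theorem norm_operator_le (hμ : 0 < μ) (hα : 0 < α) (hβ₁ : 1 ≤ β) (hβ₃ : β ≤ 3) (hN : 0 < N)
    (u : V Ω) :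
    ‖operator μ α β N u‖ ≤
      (μ + 3 * sobolevConst * √sobolevConst * N + α * (N * dampConst Ω β)) * ‖u‖ := by
  have hS := sobolevConst_nonneg
  have hD := dampConst_nonneg Ω β
  have hr := normV_nonneg u
  have hru := normV_le_norm u
  refine ContinuousLinearMap.opNorm_le_bound _ (by positivity) fun w => ?_
  rw [operator_apply hβ₁ hβ₃, ← inner_dampField hβ₁ hβ₃, Real.norm_eq_abs]
  have hw := norm_nonneg w
  have p0 : 0 ≤ cutoff N (normV u ^ (β - 1)) := cutoff_nonneg hN (Real.rpow_nonneg hr _)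
  have t1 : |μ * innerV u w| ≤ μ * ‖u‖ * ‖w‖ := by
    rw [abs_mul, abs_of_pos hμ, mul_assoc]
    refine mul_le_mul_of_nonneg_left ?_ hμ.le
    exact (abs_real_inner_le_norm _ _).trans
      (mul_le_mul hru (normV_le_norm w) (normV_nonneg w) (norm_nonneg u))
  have t2 : |bN N u u w| ≤ 3 * sobolevConst * √sobolevConst * N * ‖u‖ * ‖w‖ := by
    rw [bN, abs_mul, abs_of_nonneg (cutoff_nonneg hN hr)]
    calc _ ≤ cutoff N (normV u) *
          (3 * sobolevConst * √sobolevConst * normV u * normV u * ‖w‖) :=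
          mul_le_mul_of_nonneg_left (abs_b_le_norm u u w) (cutoff_nonneg hN hr)
      _ = (3 * sobolevConst * √sobolevConst * ‖w‖) * ((cutoff N (normV u) * normV u) * normV u) := by
          ring
      _ ≤ (3 * sobolevConst * √sobolevConst * ‖w‖) * (N * ‖u‖) :=
          mul_le_mul_of_nonneg_left (mul_le_mul (cutoff_mul_le hN hr) hru hr hN.le)
            (by positivity)
      _ = _ := by ring
  have t3 : |α * (cutoff N (normV u ^ (β - 1)) * inner ℝ (dampField β u) (toField w))| ≤
      α * (N * dampConst Ω β) * ‖u‖ * ‖w‖ := by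
    rw [abs_mul, abs_mul, abs_of_pos hα, abs_of_nonneg p0]
    calc _ ≤ α * (cutoff N (normV u ^ (β - 1)) * (‖dampField β u‖ * ‖w‖)) := by
          refine mul_le_mul_of_nonneg_left (mul_le_mul_of_nonneg_left ?_ p0) hα.le
          exact (abs_real_inner_le_norm _ _).trans
            (mul_le_mul_of_nonneg_left (norm_toField_le w) (norm_nonneg _))
      _ = (α * ‖w‖) * (cutoff N (normV u ^ (β - 1)) * ‖dampField β u‖) := by ring
      _ ≤ (α * ‖w‖) * (N * dampConst Ω β * ‖u‖) := by
          refine mul_le_mul_of_nonneg_left ?_ (by positivity)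
          exact (cutoff_mul_norm_dampField_le hβ₁ hβ₃ hN u).trans
            (mul_le_mul_of_nonneg_left hru (by positivity))
      _ = _ := by ring
  refine (abs_add_three _ _ _).trans ?_
  linarith

/-- The damping terms are monotone up to a lower order term. -/
theorem damping_sub_ge (hβ₁ : 1 ≤ β) (hβ₃ : β ≤ 3) (hN : 0 < N) (u v : V Ω) :
    -(2 * N * dampConst Ω β * normV (u - v) * ‖toField (u - v)‖) ≤
      cutoff N (normV u ^ (β - 1)) * damping β u (u - v) -
        cutoff N (normV v ^ (β - 1)) * damping β v (u - v) := by
  simp only [← inner_dampField hβ₁ hβ₃]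
  -- The claim is symmetric in `u` and `v`, and `abs_cutoff_rpow_sub_mul_le` carries the power of
  -- the smaller norm. The cutoff difference must therefore multiply the damping field of smaller
  -- gradient norm.
  wlog h : normV v ≤ normV u generalizing u v
  · have := this v u (le_of_not_ge h)
    have e : toField (v - u) = -toField (u - v) := by
      rw [toField_sub, toField_sub, neg_sub]
    rw [normV_sub_comm, e, norm_neg, inner_neg_right, inner_neg_right] at this
    linarith
  have hr := normV_nonneg u
  have hs := normV_nonneg v
  have hD := dampConst_nonneg Ω β
  set F := cutoff N (normV u ^ (β - 1))
  set F' := cutoff N (normV v ^ (β - 1))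
  set z := toField (u - v) with hz
  have e : F * inner ℝ (dampField β u) z - F' * inner ℝ (dampField β v) z =
      F * inner ℝ (dampField β u - dampField β v) z + (F - F') * inner ℝ (dampField β v) z := by
    rw [inner_sub_left]; ring
  have h1 : 0 ≤ F * inner ℝ (dampField β u - dampField β v) z :=
    mul_nonneg (cutoff_nonneg hN (Real.rpow_nonneg hr _))
      (inner_dampField_sub_nonneg hβ₁ hβ₃ u v)
  have h2 : |(F - F') * inner ℝ (dampField β v) z| ≤
      2 * N * dampConst Ω β * normV (u - v) * ‖z‖ := by
    rw [abs_mul]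
    have h3 := abs_cutoff_rpow_sub_mul_le (γ := β - 1) hN (by linarith) (by linarith) hs h
    rw [sub_add_cancel] at h3
    calc _ ≤ |F - F'| * (dampConst Ω β * normV v ^ β * ‖z‖) := by
          refine mul_le_mul_of_nonneg_left ?_ (abs_nonneg _)
          exact (abs_real_inner_le_norm _ _).trans
            (mul_le_mul_of_nonneg_right (norm_dampField_le hβ₁ hβ₃ v) (norm_nonneg _))
      _ = (dampConst Ω β * ‖z‖) * (|F - F'| * normV v ^ β) := by ring
      _ ≤ (dampConst Ω β * ‖z‖) * (2 * N * normV (u - v)) := by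
          refine mul_le_mul_of_nonneg_left (h3.trans ?_) (by positivity)
          refine mul_le_mul_of_nonneg_left ?_ (by positivity)
          exact (le_abs_self _).trans (abs_normV_sub_le u v)
      _ = _ := by ring
  rw [e]
  have := neg_le_of_abs_le h2
  linarith

/-- The operator is monotone up to a multiple of the `L²` norm. -/
theorem exists_operator_sub_ge (Ω : Set E3) [IsFiniteMeasure (volume.restrict Ω)] (hμ : 0 < μ)
    (hα : 0 < α) (hβ₁ : 1 ≤ β) (hβ₃ : β ≤ 3) (hN : 0 < N) :
    ∃ C : ℝ, ∀ u v : V Ω, -(C * ‖toField (u - v)‖ ^ 2) ≤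
      (operator μ α β N u - operator μ α β N v) (u - v) := by
  have hS := sobolevConst_nonneg
  have hD := dampConst_nonneg Ω β
  obtain ⟨C, hC⟩ := exists_absorption_const hμ (6 * sobolevConst * N)
    (α * (2 * N * dampConst Ω β)) sobolevConst (by positivity) hS
  refine ⟨C, fun u v => ?_⟩
  have h1 := hC (normV (u - v)) ‖toField (u - v)‖ (normV_nonneg _) (norm_nonneg _)
  have h2 := neg_le_of_abs_le (abs_bN_sub_le hN u v)
  have h3 := mul_le_mul_of_nonneg_left (damping_sub_ge hβ₁ hβ₃ hN u v) hα.le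
  have h4 : innerV u (u - v) - innerV v (u - v) = normV (u - v) ^ 2 := by
    rw [innerV, innerV, normV, ← inner_sub_left, ← grad_sub, real_inner_self_eq_norm_sq]
  have e : (operator μ α β N u - operator μ α β N v) (u - v) =
      operator μ α β N u (u - v) - operator μ α β N v (u - v) := rfl
  rw [e, operator_apply hβ₁ hβ₃, operator_apply hβ₁ hβ₃]
  have h5 : μ * innerV u (u - v) - μ * innerV v (u - v) = μ * normV (u - v) ^ 2 := by
    rw [← mul_sub, h4]
  linarith

end

/-! ### Uniqueness for abstract evolution equations -/

section Abstract

variable {X Y : Type*} [NormedAddCommGroup X] [NormedSpace ℝ X]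
  [NormedAddCommGroup Y] [InnerProductSpace ℝ Y]

theorem memLp_comp_of_norm_le {A : X → StrongDual ℝ X} (hA : Continuous A) {K : ℝ}
    (hK : ∀ x, ‖A x‖ ≤ K * ‖x‖) {ν : Measure ℝ} {U : ℝ → X} (hU : MemLp U 2 ν) :
    MemLp (fun t => A (U t)) 2 ν :=
  MemLp.of_le_mul hU (hA.comp_aestronglyMeasurable hU.1) (Eventually.of_forall fun t => hK (U t))

theorem integrableOn_dual_apply {τ T : ℝ} {G : ℝ → StrongDual ℝ X}
    (hG : MemLp G 2 (volume.restrict (Ioo τ T))) (z : X) :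
    IntegrableOn (fun t => G t z) (Ioo τ T) :=
  (hG.integrable (by norm_num)).apply_continuousLinearMap z

/-- The integrated equation for the difference of two solutions of `u' + A u = R`. -/
theorem inner_sub_eq_integral (j : X →L[ℝ] Y) {A : X → StrongDual ℝ X} (hA : Continuous A) {K : ℝ}
    (hK : ∀ x, ‖A x‖ ≤ K * ‖x‖) {τ T : ℝ} (hT : τ < T) {u v : ℝ → Y} {U W : ℝ → X}
    (hU : MemLp U 2 (volume.restrict (Ioo τ T))) (hW : MemLp W 2 (volume.restrict (Ioo τ T)))
    (hu : ∀ z, ContinuousOn (fun t => inner ℝ (u t) (j z)) (Icc τ T))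
    (hv : ∀ z, ContinuousOn (fun t => inner ℝ (v t) (j z)) (Icc τ T))
    (h0 : u τ = v τ) {R : X → (ℝ → ℝ) → ℝ}
    (hue : ∀ z, ∀ φ : ℝ → ℝ, ContDiff ℝ ∞ φ → HasCompactSupport φ → tsupport φ ⊆ Ioo τ T →
      -(∫ t in Ioo τ T, inner ℝ (u t) (j z) * deriv φ t) + ∫ t in Ioo τ T, A (U t) z * φ t = R z φ)
    (hve : ∀ z, ∀ φ : ℝ → ℝ, ContDiff ℝ ∞ φ → HasCompactSupport φ → tsupport φ ⊆ Ioo τ T →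
      -(∫ t in Ioo τ T, inner ℝ (v t) (j z) * deriv φ t) + ∫ t in Ioo τ T, A (W t) z * φ t = R z φ)
    (z : X) : ∀ t ∈ Icc τ T, inner ℝ (u t - v t) (j z) =
      ∫ s in τ..t, (A (W s) - A (U s)) z := by
  have hAU := memLp_comp_of_norm_le hA hK hU
  have hAW := memLp_comp_of_norm_le hA hK hW
  refine eq_integral_of_distribDeriv hT ?_ ?_ ?_ ?_
  · simp only [inner_sub_left]
    exact (hu z).sub (hv z)
  · simp [h0]
  · exact integrableOn_dual_apply (hAW.sub hAU) z
  · intro φ h1 h2 h3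
    have hdc : Continuous (deriv φ) := h1.continuous_deriv (by simp)
    have e1 := hue z φ h1 h2 h3
    have e2 := hve z φ h1 h2 h3
    have e3 : ∫ t in Ioo τ T, inner ℝ (u t - v t) (j z) * deriv φ t =
        (∫ t in Ioo τ T, inner ℝ (u t) (j z) * deriv φ t) -
        ∫ t in Ioo τ T, inner ℝ (v t) (j z) * deriv φ t := by
      rw [← integral_sub
        (integrableOn_mul_test ((hu z).integrableOn_Icc.mono_set Ioo_subset_Icc_self) hdc h2.deriv)
        (integrableOn_mul_test ((hv z).integrableOn_Icc.mono_set Ioo_subset_Icc_self) hdc h2.deriv)]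
      simp only [inner_sub_left, sub_mul]
    have e4 : ∫ t in Ioo τ T, (A (W t) - A (U t)) z * φ t =
        (∫ t in Ioo τ T, A (W t) z * φ t) - ∫ t in Ioo τ T, A (U t) z * φ t := by
      rw [← integral_sub
        (integrableOn_mul_test (integrableOn_dual_apply hAW z) h1.continuous h2)
        (integrableOn_mul_test (integrableOn_dual_apply hAU z) h1.continuous h2)]
      simp only [sub_apply, sub_mul]
    rw [e3, e4]
    linarith

/-- Uniqueness for evolution equations `u' + A u = R` with an operator of linear growth that is
monotone up to a multiple of the pivot norm. -/
theorem ae_eq_of_evolution_equation (j : X →L[ℝ] Y) {A : X → StrongDual ℝ X} (hA : Continuous A)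
    {K : ℝ} (hK : ∀ x, ‖A x‖ ≤ K * ‖x‖) {C : ℝ}
    (hC : ∀ x y, -(C * ‖j (x - y)‖ ^ 2) ≤ (A x - A y) (x - y))
    {τ T : ℝ} (hT : τ < T) {u v : ℝ → Y} {U U₂ : ℝ → X}
    (hU : MemLp U 2 (volume.restrict (Ioo τ T))) (hU₂ : MemLp U₂ 2 (volume.restrict (Ioo τ T)))
    (hUu : ∀ᵐ t ∂volume.restrict (Ioo τ T), j (U t) = u t)
    (hUv : ∀ᵐ t ∂volume.restrict (Ioo τ T), j (U₂ t) = v t)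
    (hu : ∀ z, ContinuousOn (fun t => inner ℝ (u t) (j z)) (Icc τ T))
    (hv : ∀ z, ContinuousOn (fun t => inner ℝ (v t) (j z)) (Icc τ T))
    (h0 : u τ = v τ) {R : X → (ℝ → ℝ) → ℝ}
    (hue : ∀ z, ∀ φ : ℝ → ℝ, ContDiff ℝ ∞ φ → HasCompactSupport φ → tsupport φ ⊆ Ioo τ T →
      -(∫ t in Ioo τ T, inner ℝ (u t) (j z) * deriv φ t) + ∫ t in Ioo τ T, A (U t) z * φ t = R z φ)
    (hve : ∀ z, ∀ φ : ℝ → ℝ, ContDiff ℝ ∞ φ → HasCompactSupport φ → tsupport φ ⊆ Ioo τ T →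
      -(∫ t in Ioo τ T, inner ℝ (v t) (j z) * deriv φ t) + ∫ t in Ioo τ T, A (U₂ t) z * φ t = R z φ) :
    ∀ᵐ t ∂volume.restrict (Ioo τ T), u t = v t := by
  have hint := inner_sub_eq_integral j hA hK hT hU hU₂ hu hv h0 hue hve
  set W : ℝ → X := (Ioo τ T).indicator fun t => U t - U₂ t with hW
  set G : ℝ → StrongDual ℝ (X) := (Ioo τ T).indicator fun t =>
    A (U₂ t) - A (U t) with hG
  -- Extension by zero to the left of `τ` creates no jump because `u τ = v τ`, so `G` is still the
  -- derivative of `w` there. A jump may occur at `T`, hence the restriction `t < T` in what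
  -- follows.
  set w : ℝ → Y := fun t => if t < τ then 0 else u t - v t with hw
  have hWm : MemLp W 2 volume :=
    (memLp_indicator_iff_restrict measurableSet_Ioo).2 (hU.sub hU₂)
  have hGm : MemLp G 2 volume :=
    (memLp_indicator_iff_restrict measurableSet_Ioo).2
      ((memLp_comp_of_norm_le hA hK hU₂).sub (memLp_comp_of_norm_le hA hK hU))
  have hGi : ∀ z a c, IntervalIntegrable (fun r => G r z) volume a c := by
    intro z a c
    have h1 : IntegrableOn G (uIoc a c) :=
      ((hGm.locallyIntegrable (by norm_num)).integrableOn_isCompact isCompact_uIcc).mono_set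
        uIoc_subset_uIcc
    exact intervalIntegrable_iff.2 (h1.apply_continuousLinearMap z)
  have hwG : ∀ z t, t < T → inner ℝ (w t) (j z) = ∫ r in τ..t, G r z := by
    intro z t ht
    rcases lt_or_ge t τ with h | h
    · have h0 : ∫ r in τ..t, G r z = 0 := by
        refine intervalIntegral.integral_zero_ae (Eventually.of_forall fun r hr => ?_)
        rw [uIoc_of_ge h.le] at hr
        have : r ∉ Ioo τ T := fun hh => not_lt.2 hr.2 hh.1
        simp [hG, this]
      rw [h0]
      simp [hw, h]
    · have h1 : w t = u t - v t := by simp [hw, not_lt.2 h]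
      rw [h1, hint z t ⟨h, ht.le⟩]
      refine intervalIntegral.integral_congr_ae (Eventually.of_forall fun r hr => ?_)
      rw [uIoc_of_le h] at hr
      have : r ∈ Ioo τ T := ⟨hr.1, hr.2.trans_lt ht⟩
      simp only [hG, indicator_of_mem this]
  have hwW : ∀ᵐ t, t < T → w t = j (W t) := by
    have a3 := (ae_restrict_iff' measurableSet_Ioo).1 hUu
    have a4 := (ae_restrict_iff' measurableSet_Ioo).1 hUv
    have a5 : ∀ᵐ x : ℝ, x ≠ τ := by simp [ae_iff, measure_singleton]
    filter_upwards [a3, a4, a5] with t k3 k4 k5 ht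
    rcases lt_or_gt_of_ne k5 with h | h
    · have : t ∉ Ioo τ T := fun hh => lt_asymm h hh.1
      simp only [hw, h, if_true, hW, indicator_of_notMem this, map_zero]
    · have hm : t ∈ Ioo τ T := ⟨h, ht⟩
      simp only [hw, not_lt.2 h.le, if_false, hW, indicator_of_mem hm, map_sub]
      rw [k3 hm, k4 hm]
  have hen := energy_identity (j) hGm hWm hwW (fun s t hst ht z => by
    rw [inner_sub_left, hwG z t ht, hwG z s (hst.trans_lt ht)]
    exact intervalIntegral.integral_interval_sub_left (hGi z _ _) (hGi z _ _))
  set y : ℝ → ℝ := fun r => ‖j (W r)‖ ^ 2 with hy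
  have hyI : Integrable y volume :=
    ((j).comp_memLp' hWm).integrable_norm_pow (by simp)
  have hGW : ∀ r, G r (W r) ≤ C * y r := by
    intro r
    by_cases hr : r ∈ Ioo τ T
    · have h1 := hC (U r) (U₂ r)
      have h2 : (A (U₂ r) - A (U r)) (U r - U₂ r) =
          -((A (U r) - A (U₂ r)) (U r - U₂ r)) := by
        rw [← neg_apply, neg_sub]
      simp only [hG, hW, hy, indicator_of_mem hr, h2]
      linarith
    · simp [hG, hW, hy, hr]
  have hGWi : Integrable (fun r => G r (W r)) volume := by
    have hbd : Integrable (fun r => ‖G r‖ * ‖W r‖) volume := hGm.norm.integrable_mul hWm.norm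
    refine hbd.mono' ?_ (Eventually.of_forall fun r => (G r).le_opNorm (W r))
    exact (ContinuousLinearMap.id ℝ (StrongDual ℝ (X))).aestronglyMeasurable_comp₂ hGm.1 hWm.1
  have hgr : ∀ᵐ t ∂volume.restrict (Ioo τ T), y t ≤ (2 * C) * ∫ s in τ..t, y s := by
    refine (ae_restrict_iff' measurableSet_Ioo).2 ?_
    filter_upwards [hen, hwW] with t h1 h2 ht
    have h3 : y t = 2 * ∫ r in Iic t, G r (W r) := by
      rw [← h1 ht.2, h2 ht.2]
    have h4 : ∫ r in Iic t, G r (W r) ≤ ∫ r in Iic t, C * y r :=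
      integral_mono hGWi.integrableOn (hyI.const_mul C).integrableOn hGW
    have h5 : ∫ r in Iic τ, y r = 0 := by
      refine setIntegral_eq_zero_of_forall_eq_zero fun r hr => ?_
      have : r ∉ Ioo τ T := fun hh => not_lt.2 hr hh.1
      simp [hy, hW, this]
    have h6 := intervalIntegral.integral_Iic_sub_Iic (a := τ) (b := t)
      (hyI.integrableOn (s := Iic τ)) (hyI.integrableOn (s := Iic t))
    rw [integral_const_mul] at h4
    rw [h5, sub_zero] at h6
    rw [h3, ← h6]
    linarith
  have hfin := ae_nonpos_of_le_mul_integral hyI.integrableOn (fun t => sq_nonneg _) hgr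
  filter_upwards [hfin, hUu, hUv, ae_restrict_mem measurableSet_Ioo] with t k1 k2 k3 k4
  have k5 : j (W t) = 0 := by
    have : y t = 0 := le_antisymm k1 (sq_nonneg _)
    exact norm_eq_zero.1 (pow_eq_zero_iff (by norm_num) |>.1 this)
  simp only [hW, indicator_of_mem k4, map_sub, k2, k3] at k5
  exact sub_eq_zero.1 k5

end Abstract

/-! ### Uniqueness of weak solutions -/

section

variable [IsFiniteMeasure (volume.restrict Ω)] {μ α β N : ℝ}

/-- As `β + 1 ≤ 4 ≤ 6`, every element of `V` is an admissible test field, so the weak formulation is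
an identity of functionals on all of `V`. -/
theorem memLp_toField_of_le (hβ₃ : β ≤ 3) (w : V Ω) :
    MemLp (toField w : E3 → E3) (ENNReal.ofReal (β + 1)) (volume.restrict Ω) := by
  refine (memLp_six w).mono_exponent ?_
  rw [show (6 : ℝ≥0∞) = ENNReal.ofReal 6 by simp]
  exact ENNReal.ofReal_le_ofReal (by linarith)

/-- The equation of a weak solution in terms of its weakly continuous representative. -/
theorem SatisfiesEquation.operator_form (hβ₁ : 1 ≤ β) (hβ₃ : β ≤ 3) {τ T : ℝ} {f u u' : ℝ → H Ω}
    {U : ℝ → V Ω} (h : SatisfiesEquation μ α β N τ T f u U)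
    (huu : ∀ᵐ t ∂volume.restrict (Ioo τ T), u' t = u t) (z : V Ω) (φ : ℝ → ℝ)
    (h1 : ContDiff ℝ ∞ φ) (h2 : HasCompactSupport φ) (h3 : tsupport φ ⊆ Ioo τ T) :
    -(∫ t in Ioo τ T, inner ℝ (u' t : L2 Ω) (toFieldL Ω z) * deriv φ t) +
      ∫ t in Ioo τ T, operator μ α β N (U t) z * φ t =
      ∫ t in Ioo τ T, inner ℝ (f t : L2 Ω) (toField z) * φ t := by
  rw [← h z (memLp_toField_of_le hβ₃ z) φ h1 h2 h3]
  simp only [operator_apply hβ₁ hβ₃, toFieldL_apply]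
  congr 2
  refine integral_congr_ae ?_
  filter_upwards [huu] with t ht
  rw [ht]

/-- Two weak solutions on a bounded time interval coincide almost everywhere. -/
theorem IsWeakSolution.ae_eq (hμ : 0 < μ) (hα : 0 < α) (hβ₁ : 1 ≤ β) (hβ₃ : β ≤ 3) (hN : 0 < N)
    {τ T : ℝ} (hT : τ < T) {f u v : ℝ → H Ω} {uτ : H Ω}
    (hu : IsWeakSolution μ α β N τ T f uτ u) (hv : IsWeakSolution μ α β N τ T f uτ v) :
    ∀ᵐ t ∂volume.restrict (Ioo τ T), u t = v t := by
  obtain ⟨-, ⟨u', hu', huu, hu0⟩, U, ⟨hU, hUu⟩, -, hue⟩ := hu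
  obtain ⟨-, ⟨v', hv', hvv, hv0⟩, W, ⟨hW, hWv⟩, -, hve⟩ := hv
  obtain ⟨C, hC⟩ := exists_operator_sub_ge (μ := μ) (α := α) (β := β) (N := N) Ω hμ hα hβ₁ hβ₃ hN
  have hUu' : ∀ᵐ t ∂volume.restrict (Ioo τ T), toFieldL Ω (U t) = (u' t : L2 Ω) := by
    filter_upwards [hUu, huu] with t k1 k2
    rw [toFieldL_apply, k1, k2]
  have hWv' : ∀ᵐ t ∂volume.restrict (Ioo τ T), toFieldL Ω (W t) = (v' t : L2 Ω) := by
    filter_upwards [hWv, hvv] with t k1 k2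
    rw [toFieldL_apply, k1, k2]
  have key := ae_eq_of_evolution_equation (toFieldL Ω) (continuous_operator hβ₁ hβ₃ hN)
    (norm_operator_le hμ hα hβ₁ hβ₃ hN) hC hT hU hW hUu' hWv'
    (fun z => hu' ⟨toField z, toField_mem_H z⟩) (fun z => hv' ⟨toField z, toField_mem_H z⟩)
    (by rw [hu0, hv0])
    (hue.operator_form hβ₁ hβ₃ huu) (hve.operator_form hβ₁ hβ₃ hvv)
  filter_upwards [key, huu, hvv] with t k1 k2 k3
  rw [← k2, ← k3]
  exact Subtype.ext k1

end

/-- Weakly continuous functions that agree almost everywhere agree everywhere. -/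
theorem WeaklyContinuousOn.eq_of_ae_eq {τ T : ℝ} (hT : τ < T) {u v : ℝ → H Ω}
    (hu : WeaklyContinuousOn u (Icc τ T)) (hv : WeaklyContinuousOn v (Icc τ T))
    (h : ∀ᵐ t ∂volume.restrict (Ioo τ T), u t = v t) : ∀ t ∈ Icc τ T, u t = v t := by
  intro t ht
  refine ext_inner_right ℝ fun z => ?_
  have hae : (fun t => inner ℝ (u t) z) =ᵐ[volume.restrict (Icc τ T)]
      fun t => inner ℝ (v t) z := by
    rw [← restrict_Ioo_eq_restrict_Icc]
    filter_upwards [h] with t ht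
    rw [ht]
  exact Measure.eqOn_Icc_of_ae_eq volume hT.ne hae (hu z) (hv z) ht

end GMNSED

end

theorem mainTheorem8 (Ω : Set GMNSED.E3) (hΩo : IsOpen Ω) (hΩb : Bornology.IsBounded Ω)
    (μ α β N τ : ℝ) (hμ : 0 < μ) (hα : 0 < α) (hβ₁ : 1 ≤ β) (hβ₃ : β ≤ 3) (hN : 0 < N)
    (f : ℝ → GMNSED.H Ω)
    (hf : ∀ T, τ < T → MemLp f 2 (volume.restrict (Ioo τ T)))
    (uτ : GMNSED.H Ω) :
    (∀ T, τ < T → ∀ u v : ℝ → GMNSED.H Ω,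
      GMNSED.IsWeakSolution μ α β N τ T f uτ u →
      GMNSED.IsWeakSolution μ α β N τ T f uτ v →
      (∀ᵐ t ∂volume.restrict (Ioo τ T), u t = v t) ∧
      (GMNSED.WeaklyContinuousOn u (Icc τ T) → GMNSED.WeaklyContinuousOn v (Icc τ T) →
        ∀ t ∈ Icc τ T, u t = v t)) ∧
    (∀ u v : ℝ → GMNSED.H Ω,
      GMNSED.IsGlobalWeakSolution μ α β N τ f uτ u →
      GMNSED.IsGlobalWeakSolution μ α β N τ f uτ v →
      (∀ᵐ t ∂volume.restrict (Ioi τ), u t = v t) ∧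
      (GMNSED.WeaklyContinuousOn u (Ici τ) → GMNSED.WeaklyContinuousOn v (Ici τ) →
        ∀ t ∈ Ici τ, u t = v t)) := by
  have : IsFiniteMeasure (volume.restrict Ω) :=
    isFiniteMeasure_restrict.2 hΩb.measure_lt_top.ne
  have hloc : ∀ T, τ < T → ∀ u v : ℝ → GMNSED.H Ω,
      GMNSED.IsWeakSolution μ α β N τ T f uτ u →
      GMNSED.IsWeakSolution μ α β N τ T f uτ v →
      ∀ᵐ t ∂volume.restrict (Ioo τ T), u t = v t := fun T hT u v hu hv =>
    hu.ae_eq hμ hα hβ₁ hβ₃ hN hT hv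
  refine ⟨fun T hT u v hu hv => ⟨hloc T hT u v hu hv, fun hcu hcv =>
    hcu.eq_of_ae_eq hT hcv (hloc T hT u v hu hv)⟩, fun u v hu hv => ⟨?_, fun hcu hcv t ht => ?_⟩⟩
  · have hcover : Ioi τ ⊆ ⋃ n : ℕ, Ioo τ (τ + (n + 1)) := by
      intro t ht
      obtain ⟨n, hn⟩ := exists_nat_gt (t - τ)
      exact mem_iUnion.2 ⟨n, ht, by linarith⟩
    refine ae_restrict_of_ae_restrict_of_subset hcover ?_
    rw [ae_restrict_iUnion_iff]
    intro n
    have hT : τ < τ + ((n : ℝ) + 1) := lt_add_of_pos_right _ (by positivity)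
    exact hloc _ hT u v (hu _ hT) (hv _ hT)
  · have hT : τ < t + 1 := lt_of_le_of_lt ht (lt_add_one t)
    exact GMNSED.WeaklyContinuousOn.eq_of_ae_eq hT (fun h => (hcu h).mono Icc_subset_Ici_self)
      (fun h => (hcv h).mono Icc_subset_Ici_self) (hloc _ hT u v (hu _ hT) (hv _ hT)) t
      ⟨ht, by linarith⟩
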